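/- **Setting.** Let $A\in\mathbb R^{N\times N}$, $A\neq 0$, and $0\le p\le 1$. The nonzero entries of $A$ are labelled bijectively by a set of in-range pairs $(d,m)$, $0\le d<D$, $0\le m<M$: the in-range label $(d,m)$ sits at row $i(d,m)$ and column $j(d,m)$, and $A_{i(d,m),j(d,m)}=A_d$ with nonzero data values $A_d$. Other pairs $(d,m)$ are padding. Let $O_c,O_r$ be unitaries from the register $(d,m)$ to the register of the index $0,\dots,N-1$ and $s\in\{0,\dots,S-1\}$ (so $MD=NS$) such that, on in-range labels, $O_c|d\rangle|m\rangle=|j(d,m)\rangle|s_c\rangle$ for some $s_c<S_c$ and $O_r|d\rangle|m\rangle=|i(d,m)\rangle|s_r\rangle$ for some $s_r<S_r$. They are arbitrary on the other labels. Let $H_{S_c},H_{S_r}$ be unitaries on the $s$ register with $H_{S_c}|0\rangle=S_c^{-1/2}\sum_{s<S_c}|s\rangle$ and $H_{S_r}|0\rangle=S_r^{-1/2}\sum_{s<S_r}|s\rangle$. The out-of-range oracle $O_{\rm rg}$ flips a qubit "del" exactly on the out-of-range labels. Let $R(x)=e^{-i\arccos(x)X}$, so that $\langle 0|R(x)|0\rangle=x$.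 Sums of powers $|A_{ij}|^q$ run over the nonzero entries only (this matters only for $q=0$). The halves of the split data loading are $$U_c^\dagger = R\!\left(\tfrac{\operatorname{sgn}(A_d)|A_d|^p}{\max_{d'}|A_{d'}|^p}\right)O_c^\dagger H_{S_c},\qquad U_r=H_{S_r}^\dagger O_r\,R\!\left(\tfrac{|A_d|^{1-p}}{\max_{d'}|A_{d'}|^{1-p}}\right),$$ where the rotations act on two separate flag qubits data0 and data1, and are multiplexed on $d$. For a unitary $U$ and phases $\Phi=(\varphi_1,\dots,\varphi_n)$, $n$ odd, the singular value transformation circuit of $U$ is $$(\mathrm{Had}\otimes 1)(|0\rangle\langle 0|\otimes U_\Phi+|1\rangle\langle1|\otimes U_{-\Phi})(\mathrm{Had}\otimes1),\qquad U_\Phi=e^{i\varphi_1(2\tilde\Pi-1)}Ue^{i\varphi_2(2\Pi-1)}U^\dagger e^{i\varphi_3(2\tilde\Pi-1)}U\cdots.$$ Here one ancilla is added, and $\Pi$, $\tilde\Pi$ project onto the accepted flag states before and after $U$: data qubit and $s$ equal to $0$ on the outer side, data qubit $0$ and $(d,m)$ in range on the inner side. It uses $U$ or $U^\dagger$ $n$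 times. Its polynomial is $$P_\Phi(x)=\operatorname{Re}\langle 0|e^{i\varphi_1 Z}\rho(x)\cdots e^{i\varphi_nZ}\rho(x)|0\rangle,\qquad \rho(x)=\begin{pmatrix}x&\sqrt{1-x^2}\\ \sqrt{1-x^2}&-x\end{pmatrix}.$$ A circuit $W$ is a block encoding of $A$ with subnormalisation $\alpha$ and error $\eta$ if it is unitary and $\|A-\alpha\langle 0|W|0\rangle\|\le\eta$ in operator norm, with all flags ($s$ included) initialised and postselected as $0$. **Theorem.** There is an absolute constant $C>0$ such that the following holds for all data as above. 1. The split circuit $U_r\,O_{\rm rg}\,U_c^\dagger$ is an exact block encoding of $A$ with subnormalisation $(\sqrt{S_c}\max_d|A_d|^p)(\sqrt{S_r}\max_d|A_d|^{1-p})$. 2. $U_c^\dagger$ and $U_r$ are unitary. With data0, del, $s$ initialised as $0$ and data0, del postselected as $0$ (del after $O_{\rm rg}$), $U_c^\dagger$ encodes the matrix $$\sum_j|x_j\rangle\langle j|,\qquad |x_j\rangle=\sum_{(d,m)\text{ in range},\,j(d,m)=j}\frac{\operatorname{sgn}(A_d)|A_d|^p}{\sqrt{S_c}\max_{d'}|A_{d'}|^p}|d\rangle|m\rangle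 .$$ It equals $W\operatorname{diag}(\zeta_j)$ for an isometry $W$, so its singular values are $$\zeta_j=\sqrt{\frac{\sum_i|A_{ij}|^{2p}}{S_c\max_d|A_d|^{2p}}}.$$ Symmetrically, $U_r$ encodes $$\sum_i|i\rangle\langle y_i|,\qquad |y_i\rangle=\sum_{(d,m)\text{ in range},\,i(d,m)=i}\frac{|A_d|^{1-p}}{\sqrt{S_r}\max_{d'}|A_{d'}|^{1-p}}|d\rangle|m\rangle .$$ This equals $\operatorname{diag}(\zeta'_i)W'^\dagger$ for an isometry $W'$, so its singular values are $$\zeta_i'=\sqrt{\frac{\sum_j|A_{ij}|^{2-2p}}{S_r\max_d|A_d|^{2-2p}}}.$$ 3. With $\gamma_c=2^{-1/4}/\max_j\zeta_j$ and $\gamma_r=2^{-1/4}/\max_i\zeta'_i$, $$\frac{\sqrt{S_c}\max_d|A_d|^p\cdot\sqrt{S_r}\max_d|A_d|^{1-p}}{\gamma_c\gamma_r}=\alpha:=\sqrt{2\max_j\sum_i|A_{ij}|^{2p}\cdot\max_i\sum_j|A_{ij}|^{2-2p}} .$$ 4. Let $\varepsilon\in\mathbb R$, and let $\Phi_c,\Phi_r$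 be phase sequences of odd length with $|P_{\Phi_c}(x)-\gamma_cx|\le\varepsilon$ for $0\le x\le 2^{-1/4}/\gamma_c$ and $|P_{\Phi_r}(x)-\gamma_rx|\le\varepsilon$ for $0\le x\le2^{-1/4}/\gamma_r$. Replacing $U_c^\dagger$ and $U_r$ in $U_r\,O_{\rm rg}\,U_c^\dagger$ by their singular value transformation circuits with phases $\Phi_c$, $\Phi_r$ (and separate ancillas) gives a block encoding of $A$ with subnormalisation $\alpha$ and error at most $(2\varepsilon+\varepsilon^2)\,\alpha$. 5. For every $0<\varepsilon<1/2$ such phases exist, even with relative accuracy: $|P_{\Phi_c}(x)-\gamma_cx|\le\varepsilon\gamma_cx$ and $|P_{\Phi_r}(x)-\gamma_rx|\le\varepsilon\gamma_rx$ on the same intervals. They can be chosen with at most $C\gamma_c\log(\gamma_c/\varepsilon)$ uses of $U_c$ and at most $C\gamma_r\log(\gamma_r/\varepsilon)$ uses of $U_r$. -/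

import Mathlib

open Matrix Kronecker

namespace Preamp

/-- Unitarity of an operator from a register with basis `α` to a register with basis `β`
(of the same total dimension). -/
def IsUnitary {α β : Type*} [Fintype α] [Fintype β] [DecidableEq α] [DecidableEq β]
    (U : Matrix β α ℂ) : Prop :=
  U * Uᴴ = 1 ∧ Uᴴ * U = 1

/-- A labelling of the nonzero entries of a real matrix `A` by pairs (data index `d`, multiplicity
index `m`). Labels outside `inRange` are padding, and `row`, `col` are irrelevant on them. -/
structure Labelling {N : ℕ} (A : Matrix (Fin N) (Fin N) ℝ) (D M : ℕ) where
  val : Fin D → ℝ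
  val_ne_zero : ∀ d, val d ≠ 0
  inRange : Finset (Fin D × Fin M)
  row : Fin D × Fin M → Fin N
  col : Fin D × Fin M → Fin N
  entry_eq : ∀ x ∈ inRange, A (row x) (col x) = val x.1
  existsUnique_label : ∀ i j, A i j ≠ 0 → ∃! x, x ∈ inRange ∧ row x = i ∧ col x = j

/-- Column and row oracles `O_c |d⟩|m⟩ = |j⟩|s_c⟩`, `O_r |d⟩|m⟩ = |i⟩|s_r⟩` (prescribed on in-range
labels, where `s_c < Sc`, `s_r < Sr`; arbitrary elsewhere, as long as they are unitary) and
diffusion gates `H|0⟩ = Sc^(-1/2) ∑_{s < Sc} |s⟩`, `H|0⟩ = Sr^(-1/2) ∑_{s < Sr} |s⟩`. -/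
structure Oracles {N D M : ℕ} {A : Matrix (Fin N) (Fin N) ℝ} (L : Labelling A D M)
    (S : ℕ) [NeZero S] (Sc Sr : ℕ) where
  Oc : Matrix (Fin N × Fin S) (Fin D × Fin M) ℂ
  Or : Matrix (Fin N × Fin S) (Fin D × Fin M) ℂ
  Hc : Matrix (Fin S) (Fin S) ℂ
  Hr : Matrix (Fin S) (Fin S) ℂ
  Oc_unitary : IsUnitary Oc
  Or_unitary : IsUnitary Or
  Hc_unitary : IsUnitary Hc
  Hr_unitary : IsUnitary Hr
  Oc_spec : ∀ x ∈ L.inRange, ∃ s : Fin S, (s : ℕ) < Sc ∧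
    ∀ y, Oc y x = if y = (L.col x, s) then 1 else 0
  Or_spec : ∀ x ∈ L.inRange, ∃ s : Fin S, (s : ℕ) < Sr ∧
    ∀ y, Or y x = if y = (L.row x, s) then 1 else 0
  Hc_spec : ∀ s : Fin S, Hc s 0 = if (s : ℕ) < Sc then 1 / (Real.sqrt Sc : ℂ) else 0
  Hr_spec : ∀ s : Fin S, Hr s 0 = if (s : ℕ) < Sr then 1 / (Real.sqrt Sr : ℂ) else 0

noncomputable section

/-- The rotation `exp(-i θ X / 2)`. -/
def rotX (θ : ℝ) : Matrix (Fin 2) (Fin 2) ℂ :=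
  !![(Real.cos (θ / 2) : ℂ), -Complex.I * (Real.sin (θ / 2) : ℂ);
     -Complex.I * (Real.sin (θ / 2) : ℂ), (Real.cos (θ / 2) : ℂ)]

/-- The gate `R(x)`, with `R(x)|0⟩ = x|0⟩ - i √(1-x²) |1⟩`. -/
def rot (x : ℝ) : Matrix (Fin 2) (Fin 2) ℂ := rotX (2 * Real.arccos x)

/-- The rotation `R (x d)` of a data qubit, multiplexed on the data index `d`. -/
def multiplexedRot {D M : ℕ} (x : Fin D → ℝ) :
    Matrix (Fin 2 × Fin D × Fin M) (Fin 2 × Fin D × Fin M) ℂ :=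
  fun a b => if a.2 = b.2 then rot (x a.2.1) a.1 b.1 else 0

/-- The operator `X` on registers with bases `F × α → F × β`, extended by the identity on a further
register with basis `G`. -/
def idle {F α β : Type*} (G : Type*) [DecidableEq G] (X : Matrix (F × β) (F × α) ℂ) :
    Matrix (F × G × β) (F × G × α) ℂ :=
  fun a b => if a.2.1 = b.2.1 then X (a.1, a.2.2) (b.1, b.2.2) else 0

section Scheme

variable {N D M : ℕ} {A : Matrix (Fin N) (Fin N) ℝ} (L : Labelling A D M)

/-- The maximum of `|A_d|^q` over the data items. -/
def dataMax (q : ℝ) : ℝ := ⨆ d, |L.val d| ^ q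

/-- The out-of-range oracle on (del, (d, m)): it flips del exactly on out-of-range labels. -/
def rangeGate : Matrix (Fin 2 × Fin D × Fin M) (Fin 2 × Fin D × Fin M) ℂ :=
  fun a b => if a.2 = b.2 ∧ a.1 = (if b.2 ∈ L.inRange then b.1 else b.1 + 1) then 1 else 0

variable {S : ℕ} [NeZero S] {Sc Sr : ℕ} {L} (O : Oracles L S Sc Sr) (p : ℝ)

/-- The first half `U_c†` on (data0, (j, s)) → (data0, (d, m)): diffusion, `O_c†`, rotation by
`sgn(A_d)|A_d|^p / max |A_d|^p`. -/
def firstHalf : Matrix (Fin 2 × Fin D × Fin M) (Fin 2 × Fin N × Fin S) ℂ :=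
  multiplexedRot (M := M) (fun d => Real.sign (L.val d) * |L.val d| ^ p / dataMax L p)
    * ((1 : Matrix (Fin 2) (Fin 2) ℂ) ⊗ₖ O.Ocᴴ)
    * ((1 : Matrix (Fin 2) (Fin 2) ℂ) ⊗ₖ ((1 : Matrix (Fin N) (Fin N) ℂ) ⊗ₖ O.Hc))

/-- The second half `U_r` on (data1, (d, m)) → (data1, (i, s)): rotation by
`|A_d|^(1-p) / max |A_d|^(1-p)`, `O_r`, inverse diffusion. -/
def secondHalf : Matrix (Fin 2 × Fin N × Fin S) (Fin 2 × Fin D × Fin M) ℂ :=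
  ((1 : Matrix (Fin 2) (Fin 2) ℂ) ⊗ₖ ((1 : Matrix (Fin N) (Fin N) ℂ) ⊗ₖ O.Hrᴴ))
    * ((1 : Matrix (Fin 2) (Fin 2) ℂ) ⊗ₖ O.Or)
    * multiplexedRot (M := M) (fun d => |L.val d| ^ (1 - p) / dataMax L (1 - p))

/-- The matrix encoded by `U_c†`: flags data0, del, s initialised to `0`; flags data0, del
postselected as `0` (del after the out-of-range oracle). -/
def firstBlock : Matrix (Fin D × Fin M) (Fin N) ℂ :=
  fun x j => (((1 : Matrix (Fin 2) (Fin 2) ℂ) ⊗ₖ rangeGate L) * idle (Fin 2) (firstHalf O p))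
    (0, 0, x) (0, 0, j, 0)

/-- The matrix encoded by `U_r`: flags data1, del initialised to `0` (del before the out-of-range
oracle); flags data1, del, s postselected as `0`. -/
def secondBlock : Matrix (Fin N) (Fin D × Fin M) ℂ :=
  fun i x => (idle (Fin 2) (secondHalf O p) * ((1 : Matrix (Fin 2) (Fin 2) ℂ) ⊗ₖ rangeGate L))
    (0, 0, i, 0) (0, 0, x)

/-- The circuit `V_r · O_rg · V_c` for a first part `V_c` with its own flags `Fc` and a second part
`V_r` with its own flags `Fr`; the del qubit is only touched by the out-of-range oracle. -/
def combine (L : Labelling A D M) {Fc Fr : Type*} [Fintype Fc] [Fintype Fr]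
    [DecidableEq Fc] [DecidableEq Fr]
    (Vr : Matrix (Fr × Fin N × Fin S) (Fr × Fin D × Fin M) ℂ)
    (Vc : Matrix (Fc × Fin D × Fin M) (Fc × Fin N × Fin S) ℂ) :
    Matrix (Fc × Fr × Fin 2 × Fin N × Fin S) (Fc × Fr × Fin 2 × Fin N × Fin S) ℂ :=
  ((1 : Matrix Fc Fc ℂ) ⊗ₖ idle (Fin 2) Vr)
    * ((1 : Matrix Fc Fc ℂ) ⊗ₖ ((1 : Matrix Fr Fr ℂ) ⊗ₖ rangeGate L))
    * idle Fr (idle (Fin 2) Vc)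

/-- `W` is a block encoding of `A` with subnormalisation `α` up to error `err` in operator norm;
all flags, including the register `s`, are initialised and postselected as `0`. -/
def IsBlockEncoding {Fc Fr : Type*} [Fintype Fc] [Fintype Fr]
    [DecidableEq Fc] [DecidableEq Fr] [Zero Fc] [Zero Fr]
    (W : Matrix (Fc × Fr × Fin 2 × Fin N × Fin S) (Fc × Fr × Fin 2 × Fin N × Fin S) ℂ)
    (A : Matrix (Fin N) (Fin N) ℝ) (α err : ℝ) : Prop :=
  IsUnitary W ∧
    ‖Matrix.toEuclideanCLM (n := Fin N) (𝕜 := ℂ)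
      (A.map (fun a => (a : ℂ)) -
        (α : ℂ) • Matrix.of fun i j => W (0, 0, 0, i, 0) (0, 0, 0, j, 0))‖ ≤ err

end Scheme

/-! Quantum singular value transformation. -/

/-- The gate `exp(i φ (2Π - 1))`, for the projector `Π` onto the basis states satisfying `P`. -/
def phaseGate {ι : Type*} [DecidableEq ι] (P : ι → Prop) [DecidablePred P] (φ : ℝ) :
    Matrix ι ι ℂ :=
  Matrix.diagonal fun x =>
    if P x then Complex.exp (Complex.I * φ) else Complex.exp (-(Complex.I * φ))

/-- An odd number of phases `φ₁, (φ₂, φ₃), (φ₄, φ₅), …`. -/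
abbrev Phases := ℝ × List (ℝ × ℝ)

/-- The phases with opposite signs. -/
def Phases.opp (Φ : Phases) : Phases := (-Φ.1, Φ.2.map fun a => (-a.1, -a.2))

/-- The number of uses of `U` and `U†` in the alternating sequence below. -/
def Phases.uses (Φ : Phases) : ℕ := 2 * Φ.2.length + 1

/-- The alternating phase modulation sequence
`e^{iφ₁(2Π'-1)} U · e^{iφ₂(2Π-1)} U† e^{iφ₃(2Π'-1)} U · …`, where `Π` projects onto the basis states
with `P` and `Π'` onto those with `P'`. -/
def phaseSequence {α β : Type*} [Fintype α] [Fintype β] [DecidableEq α] [DecidableEq β]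
    (U : Matrix β α ℂ) (P' : β → Prop) (P : α → Prop) [DecidablePred P'] [DecidablePred P] :
    ℝ → List (ℝ × ℝ) → Matrix β α ℂ
  | φ, [] => phaseGate P' φ * U
  | φ, a :: l => phaseGate P' φ * U * phaseGate P a.1 * Uᴴ * phaseSequence U P' P a.2 l

/-- The Hadamard gate. -/
def hadamard : Matrix (Fin 2) (Fin 2) ℂ := (1 / (Real.sqrt 2 : ℂ)) • !![1, 1; 1, -1]

/-- The singular value transformation circuit, with one ancilla: Hadamard on the ancilla, the
sequence with phases `Φ` (ancilla `0`) or `-Φ` (ancilla `1`), Hadamard on the ancilla. -/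
def svtCircuit {α β : Type*} [Fintype α] [Fintype β] [DecidableEq α] [DecidableEq β]
    (U : Matrix β α ℂ) (P' : β → Prop) (P : α → Prop) [DecidablePred P'] [DecidablePred P]
    (Φ : Phases) : Matrix (Fin 2 × β) (Fin 2 × α) ℂ :=
  (hadamard ⊗ₖ (1 : Matrix β β ℂ))
    * (Matrix.of fun (a : Fin 2 × β) (b : Fin 2 × α) => if a.1 = b.1 then
        (if a.1 = 0 then phaseSequence U P' P Φ.1 Φ.2 a.2 b.2
          else phaseSequence U P' P Φ.opp.1 Φ.opp.2 a.2 b.2) else 0)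
    * (hadamard ⊗ₖ (1 : Matrix α α ℂ))

/-- The odd real polynomial (on `[-1, 1]`) that the circuit above applies to the singular values:
the real part of `⟨0| e^{iφ₁Z} R(x) e^{iφ₂Z} R(x) … |0⟩` with the reflection
`R(x) = [[x, √(1-x²)], [√(1-x²), -x]]`. -/
def svtPolynomial (Φ : Phases) (x : ℝ) : ℝ :=
  (phaseSequence
    (!![(x : ℂ), (Real.sqrt (1 - x ^ 2) : ℂ); (Real.sqrt (1 - x ^ 2) : ℂ), -(x : ℂ)])
    (fun k : Fin 2 => k = 0) (fun k : Fin 2 => k = 0) Φ.1 Φ.2 0 0).re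

section Amplified

variable {N D M : ℕ} {A : Matrix (Fin N) (Fin N) ℝ} {L : Labelling A D M}
  {S : ℕ} [NeZero S] {Sc Sr : ℕ} (O : Oracles L S Sc Sr) (p : ℝ)

/-- The transformed first half, on flags (ancilla, data0). -/
def firstAmplified (Φ : Phases) :
    Matrix ((Fin 2 × Fin 2) × Fin D × Fin M) ((Fin 2 × Fin 2) × Fin N × Fin S) ℂ :=
  (svtCircuit (firstHalf O p) (fun y => y.1 = 0 ∧ y.2 ∈ L.inRange)
    (fun x => x.1 = 0 ∧ x.2.2 = 0) Φ).submatrix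
      (Equiv.prodAssoc _ _ _) (Equiv.prodAssoc _ _ _)

/-- The transformed second half, on flags (ancilla, data1). -/
def secondAmplified (Φ : Phases) :
    Matrix ((Fin 2 × Fin 2) × Fin N × Fin S) ((Fin 2 × Fin 2) × Fin D × Fin M) ℂ :=
  (svtCircuit (secondHalf O p) (fun x => x.1 = 0 ∧ x.2.2 = 0)
    (fun y => y.1 = 0 ∧ y.2 ∈ L.inRange) Φ).submatrix
      (Equiv.prodAssoc _ _ _) (Equiv.prodAssoc _ _ _)

end Amplified

/-- `∑_i |A_ij|^q`, over the nonzero entries of column `j` (this matters only for `q = 0`). -/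
def colSum {N : ℕ} (A : Matrix (Fin N) (Fin N) ℝ) (q : ℝ) (j : Fin N) : ℝ :=
  ∑ i, if A i j = 0 then 0 else |A i j| ^ q

/-- `∑_j |A_ij|^q`, over the nonzero entries of row `i` (this matters only for `q = 0`). -/
def rowSum {N : ℕ} (A : Matrix (Fin N) (Fin N) ℝ) (q : ℝ) (i : Fin N) : ℝ :=
  ∑ j, if A i j = 0 then 0 else |A i j| ^ q

section Parameters

variable {N D M : ℕ} {A : Matrix (Fin N) (Fin N) ℝ} (L : Labelling A D M) (p : ℝ)

/-- The numbers `ζ_j = √(∑_i |A_ij|^{2p} / (Sc max |A_d|^{2p}))`. -/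
def zetaCol (Sc : ℕ) (j : Fin N) : ℝ :=
  Real.sqrt (colSum A (2 * p) j / (Sc * dataMax L (2 * p)))

/-- The numbers `ζ_i = √(∑_j |A_ij|^{2-2p} / (Sr max |A_d|^{2-2p}))`. -/
def zetaRow (Sr : ℕ) (i : Fin N) : ℝ :=
  Real.sqrt (rowSum A (2 - 2 * p) i / (Sr * dataMax L (2 - 2 * p)))

/-- The amplification factor of the first half. -/
def gammaCol (Sc : ℕ) : ℝ := (2 : ℝ) ^ (-(1 / 4) : ℝ) / ⨆ j, zetaCol L p Sc j

/-- The amplification factor of the second half. -/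
def gammaRow (Sr : ℕ) : ℝ := (2 : ℝ) ^ (-(1 / 4) : ℝ) / ⨆ i, zetaRow L p Sr i

end Parameters

/-- `√(2 max_j ∑_i |A_ij|^{2p} max_i ∑_j |A_ij|^{2-2p})`. -/
def preampNorm {N : ℕ} (A : Matrix (Fin N) (Fin N) ℝ) (p : ℝ) : ℝ :=
  Real.sqrt (2 * (⨆ j, colSum A (2 * p) j) * ⨆ i, rowSum A (2 - 2 * p) i)

end

end Preamp

open Preamp

/-!
The accepted blocks of the two halves are computed directly from the oracles: the column `j` of
`firstBlock` is supported on the in-range labels of the column `j` of `A`, and the row `i` of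
`secondBlock` on those of the row `i`. Distinct columns therefore have disjoint supports, so that
`firstBlock = W · diag(ζ)` and `secondBlock = diag(ζ') · W'†` with isometries `W`, `W'`
(`firstBlock_svd`, `secondBlock_svd`), and the product of the two blocks is `A` divided by the
subnormalisation because `|a|^p |a|^(1-p) = |a|` (`secondBlock_mul_firstBlock`).

For a pair `v`, `w` of singular vectors of the accepted block of a unitary `U`, the spans of
`v, U†w - ζ v` and of `w, Uv - ζ w` are exchanged by `U` and `U†`, which act there as the reflection
with parameter `ζ`. The phase sequence of `U` thus acts on `v` as the product of phases and
reflections that defines `svtPolynomial` (`phaseSequence_mulVec`, `svtCircuit_block`), and the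
amplified circuit has the block `diag(P_r(ζ')) W'† W diag(P_c(ζ))`. Comparing it with
`diag(γ_r ζ') W'† W diag(γ_c ζ)`, where all scaled singular values are at most `1`, gives the error
`2 ε + ε²` (`norm_diagonal_sandwich_sub_le`, `isBlockEncoding_amplified`).

The existence of phases has two parts. First, every odd real polynomial `x E(x²)` bounded by `1` on
`[-1, 1]` is an `svtPolynomial` (`exists_phases`). In the variable `t = x²`, the polynomial
`1 - t E(t)²` is nonnegative on `[0, 1]`, hence of the form `t a² + (1 - t) b²` by the
Markov–Lukács theorem (`lukacsForm_of_nonneg`); then `(x (E + i a), √(1-x²) b)` is a normalised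
column, from which rotations and reflections are stripped off one at a time, each phase being
chosen to cancel the leading coefficients (`strip_odd`, `strip_even`). Second, a suitable `E` is
obtained from a Chebyshev polynomial of degree `O(γ)`, rescaled to separate `x ≤ 2^(-1/4) / γ` from
`x ≥ 1 / γ` by a constant gap, composed with a majority vote of `O(log(γ/ε))` trials, whose error is
exponentially small in the number of trials (`exists_amplification_poly`).
-/

namespace Preamp

/-! ### Unitarity of the circuits -/

section Unitarity

variable {α β γ : Type*} [Fintype α] [Fintype β] [Fintype γ] [DecidableEq α] [DecidableEq β]
  [DecidableEq γ]

lemma IsUnitary.mul {U : Matrix γ β ℂ} {V : Matrix β α ℂ} (hU : IsUnitary U) (hV : IsUnitary V) :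
    IsUnitary (U * V) := by
  constructor
  · rw [conjTranspose_mul, Matrix.mul_assoc, ← Matrix.mul_assoc V, hV.1, Matrix.one_mul, hU.1]
  · rw [conjTranspose_mul, Matrix.mul_assoc, ← Matrix.mul_assoc Uᴴ, hU.2, Matrix.one_mul, hV.2]

lemma IsUnitary.conjTranspose {U : Matrix β α ℂ} (hU : IsUnitary U) : IsUnitary Uᴴ := by
  constructor
  · rw [conjTranspose_conjTranspose, hU.2]
  · rw [conjTranspose_conjTranspose, hU.1]

lemma IsUnitary.one_kronecker (G : Type*) [Fintype G] [DecidableEq G] {U : Matrix β α ℂ}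
    (hU : IsUnitary U) : IsUnitary ((1 : Matrix G G ℂ) ⊗ₖ U) := by
  constructor
  · rw [conjTranspose_kronecker, ← mul_kronecker_mul, hU.1]; simp
  · rw [conjTranspose_kronecker, ← mul_kronecker_mul, hU.2]; simp

lemma IsUnitary.kronecker_one (G : Type*) [Fintype G] [DecidableEq G] {U : Matrix β α ℂ}
    (hU : IsUnitary U) : IsUnitary (U ⊗ₖ (1 : Matrix G G ℂ)) := by
  constructor
  · rw [conjTranspose_kronecker, ← mul_kronecker_mul, hU.1]; simp
  · rw [conjTranspose_kronecker, ← mul_kronecker_mul, hU.2]; simp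

lemma IsUnitary.submatrix {α' β' : Type*} [Fintype α'] [Fintype β'] [DecidableEq α']
    [DecidableEq β'] {U : Matrix β α ℂ} (hU : IsUnitary U) (e : β' ≃ β) (f : α' ≃ α) :
    IsUnitary (U.submatrix e f) := by
  constructor
  · rw [conjTranspose_submatrix, submatrix_mul_equiv, hU.1, submatrix_one_equiv]
  · rw [conjTranspose_submatrix, submatrix_mul_equiv, hU.2, submatrix_one_equiv]

/-- Moving the idle register to the front turns `idle G X` into `1 ⊗ X`. -/
lemma idle_eq_submatrix {α β F G : Type*} [DecidableEq G]
    (X : Matrix (F × β) (F × α) ℂ) :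
    idle G X = ((1 : Matrix G G ℂ) ⊗ₖ X).submatrix
      (fun a : F × G × β => (a.2.1, a.1, a.2.2)) (fun a : F × G × α => (a.2.1, a.1, a.2.2)) := by
  ext a b
  simp [idle, kroneckerMap_apply, Matrix.one_apply]

/-- The reordering of registers that moves the second one to the front. -/
def swapRegister (F G β : Type*) : F × G × β ≃ G × F × β where
  toFun a := (a.2.1, a.1, a.2.2)
  invFun a := (a.2.1, a.1, a.2.2)
  left_inv _ := rfl
  right_inv _ := rfl

lemma IsUnitary.idle {F G : Type*} [Fintype F] [DecidableEq F] [Fintype G] [DecidableEq G]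
    {X : Matrix (F × β) (F × α) ℂ} (hX : IsUnitary X) :
    IsUnitary (idle G X) := by
  rw [idle_eq_submatrix]
  exact (hX.one_kronecker G).submatrix (swapRegister F G β) (swapRegister F G α)

lemma isUnitary_rot (x : ℝ) : IsUnitary (rot x) := by
  have key : ∀ c s : ℝ, c ^ 2 + s ^ 2 = 1 → IsUnitary
      !![(c : ℂ), -Complex.I * (s : ℂ); -Complex.I * (s : ℂ), (c : ℂ)] := by
    intro c s h
    have h' : (c : ℂ) ^ 2 + (s : ℂ) ^ 2 = 1 := by exact_mod_cast h
    constructor <;>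
    · ext i j
      fin_cases i <;> fin_cases j <;>
        simp [Matrix.mul_apply, Fin.sum_univ_two, Matrix.conjTranspose_apply] <;>
        first
        | ring1
        | linear_combination h' - (s : ℂ) ^ 2 * Complex.I_sq
  exact key _ _ (Real.cos_sq_add_sin_sq _)

lemma isUnitary_multiplexedRot {D M : ℕ} (x : Fin D → ℝ) :
    IsUnitary (multiplexedRot (M := M) x) := by
  have hr := fun d => isUnitary_rot (x d)
  constructor
  · ext ⟨a, d⟩ ⟨b, e⟩
    have h := congrFun (congrFun (hr d.1).1 a) b
    simp only [Matrix.mul_apply, Matrix.conjTranspose_apply] at h ⊢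
    rw [Fintype.sum_prod_type]
    by_cases hde : d = e
    · subst hde
      simp [multiplexedRot, apply_ite, ite_mul, Matrix.one_apply] at h ⊢
      simpa using h
    · have : ∀ f g, multiplexedRot (M := M) x (a, d) (f, g) *
          star (multiplexedRot (M := M) x (b, e) (f, g)) = 0 := by
        intro f g
        by_cases h1 : d = g
        · subst h1
          simp [multiplexedRot, Ne.symm hde]
        · simp [multiplexedRot, h1]
      simp only [this, Finset.sum_const_zero]
      simp [hde]
  · ext ⟨a, d⟩ ⟨b, e⟩
    have h := congrFun (congrFun (hr d.1).2 a) b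
    simp only [Matrix.mul_apply, Matrix.conjTranspose_apply] at h ⊢
    rw [Fintype.sum_prod_type]
    by_cases hde : d = e
    · subst hde
      simp [multiplexedRot, apply_ite, ite_mul, Matrix.one_apply] at h ⊢
      simpa using h
    · have : ∀ f g, star (multiplexedRot (M := M) x (f, g) (a, d)) *
          multiplexedRot (M := M) x (f, g) (b, e) = 0 := by
        intro f g
        by_cases h1 : g = d
        · subst h1
          simp [multiplexedRot, hde]
        · simp [multiplexedRot, h1]
      simp only [this, Finset.sum_const_zero]
      simp [hde]

lemma isUnitary_rangeGate {N D M : ℕ} {A : Matrix (Fin N) (Fin N) ℝ} (L : Labelling A D M) :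
    IsUnitary (rangeGate L) := by
  have hH : (rangeGate L)ᴴ = rangeGate L := by
    ext ⟨a, x⟩ ⟨b, y⟩
    by_cases hxy : x = y
    · subst hxy
      by_cases hx : x ∈ L.inRange
      · simp [rangeGate, hx, eq_comm]
      · fin_cases a <;> fin_cases b <;> simp [rangeGate, hx]
    · simp [rangeGate, hxy, Ne.symm hxy]
  have hsq : rangeGate L * rangeGate L = 1 := by
    ext ⟨a, x⟩ ⟨b, y⟩
    rw [Matrix.mul_apply, Fintype.sum_prod_type]
    by_cases hxy : x = y
    · subst hxy
      by_cases hx : x ∈ L.inRange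
      · fin_cases a <;> fin_cases b <;>
          simp [rangeGate, hx, ite_and]
      · fin_cases a <;> fin_cases b <;>
          simp [rangeGate, hx, ite_and]
    · have : ∀ f g, rangeGate L (a, x) (f, g) * rangeGate L (f, g) (b, y) = 0 := by
        intro f g
        by_cases h1 : x = g
        · subst h1
          simp [rangeGate, hxy]
        · simp [rangeGate, h1]
      simp only [this, Finset.sum_const_zero]
      simp [hxy]
  exact ⟨by rw [hH, hsq], by rw [hH, hsq]⟩

lemma isUnitary_phaseGate (P : α → Prop) [DecidablePred P] (φ : ℝ) :
    IsUnitary (phaseGate P φ) := by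
  have h : ∀ x, (if P x then Complex.exp (Complex.I * φ) else Complex.exp (-(Complex.I * φ))) *
      star (if P x then Complex.exp (Complex.I * φ) else Complex.exp (-(Complex.I * φ))) = 1 := by
    intro x
    split_ifs <;> simp [← Complex.exp_conj, ← Complex.exp_add]
  constructor
  · rw [phaseGate, diagonal_conjTranspose, diagonal_mul_diagonal, ← diagonal_one]
    congr 1; ext x; exact h x
  · rw [phaseGate, diagonal_conjTranspose, diagonal_mul_diagonal, ← diagonal_one]
    congr 1; ext x; rw [mul_comm]; exact h x

lemma isUnitary_phaseSequence {U : Matrix β α ℂ} (hU : IsUnitary U) (P' : β → Prop) (P : α → Prop)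
    [DecidablePred P'] [DecidablePred P] (l : List (ℝ × ℝ)) :
    ∀ φ, IsUnitary (phaseSequence U P' P φ l) := by
  induction l with
  | nil => exact fun φ => (isUnitary_phaseGate P' φ).mul hU
  | cons a l ih =>
    exact fun φ => ((((isUnitary_phaseGate P' φ).mul hU).mul (isUnitary_phaseGate P a.1)).mul
      hU.conjTranspose).mul (ih a.2)

lemma isUnitary_hadamard : IsUnitary hadamard := by
  have hs : ((Real.sqrt 2 : ℝ) : ℂ) ^ 2 = 2 := by
    rw [← Complex.ofReal_pow, Real.sq_sqrt (by norm_num)]; norm_num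
  have h0 : ((Real.sqrt 2 : ℝ) : ℂ) ≠ 0 := by
    intro h; rw [h] at hs; norm_num at hs
  constructor <;>
  · ext i j
    fin_cases i <;> fin_cases j <;>
      simp [hadamard, Matrix.mul_apply, Fin.sum_univ_two, Matrix.conjTranspose_apply] <;>
      field_simp <;> rw [hs] <;> norm_num

lemma isUnitary_svtCircuit {U : Matrix β α ℂ} (hU : IsUnitary U) (P' : β → Prop) (P : α → Prop)
    [DecidablePred P'] [DecidablePred P] (Φ : Phases) : IsUnitary (svtCircuit U P' P Φ) := by
  refine ((isUnitary_hadamard.kronecker_one β).mul ?_).mul (isUnitary_hadamard.kronecker_one α)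
  have h0 := isUnitary_phaseSequence hU P' P Φ.2 Φ.1
  have h1 := isUnitary_phaseSequence hU P' P Φ.opp.2 Φ.opp.1
  generalize phaseSequence U P' P Φ.1 Φ.2 = X at h0
  generalize phaseSequence U P' P Φ.opp.1 Φ.opp.2 = Y at h1
  constructor
  · ext ⟨a, x⟩ ⟨b, y⟩
    have h0 := congrFun (congrFun h0.1 x) y
    have h1 := congrFun (congrFun h1.1 x) y
    simp only [Matrix.mul_apply, Matrix.conjTranspose_apply] at h0 h1 ⊢
    rw [Fintype.sum_prod_type]
    fin_cases a <;> fin_cases b <;> simp [Matrix.one_apply] at h0 h1 ⊢ <;> assumption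
  · ext ⟨a, x⟩ ⟨b, y⟩
    have h0 := congrFun (congrFun h0.2 x) y
    have h1 := congrFun (congrFun h1.2 x) y
    simp only [Matrix.mul_apply, Matrix.conjTranspose_apply] at h0 h1 ⊢
    rw [Fintype.sum_prod_type]
    fin_cases a <;> fin_cases b <;> simp [Matrix.one_apply] at h0 h1 ⊢ <;> assumption

end Unitarity

section UnitaryScheme

variable {N D M : ℕ} {A : Matrix (Fin N) (Fin N) ℝ} {L : Labelling A D M}
  {S : ℕ} [NeZero S] {Sc Sr : ℕ} (O : Oracles L S Sc Sr) (p : ℝ)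

lemma isUnitary_firstHalf : IsUnitary (firstHalf O p) :=
  ((isUnitary_multiplexedRot _).mul (O.Oc_unitary.conjTranspose.one_kronecker _)).mul
    ((O.Hc_unitary.one_kronecker _).one_kronecker _)

lemma isUnitary_secondHalf : IsUnitary (secondHalf O p) :=
  (((O.Hr_unitary.conjTranspose.one_kronecker _).one_kronecker _).mul
    (O.Or_unitary.one_kronecker _)).mul (isUnitary_multiplexedRot _)

lemma IsUnitary.combine {N D M S : ℕ} {A : Matrix (Fin N) (Fin N) ℝ} {L : Labelling A D M}
    {Fc Fr : Type*} [Fintype Fc] [Fintype Fr] [DecidableEq Fc] [DecidableEq Fr]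
    {Vr : Matrix (Fr × Fin N × Fin S) (Fr × Fin D × Fin M) ℂ}
    {Vc : Matrix (Fc × Fin D × Fin M) (Fc × Fin N × Fin S) ℂ}
    (hr : IsUnitary Vr) (hc : IsUnitary Vc) : IsUnitary (combine L Vr Vc) :=
  (((IsUnitary.idle hr).one_kronecker _).mul
    (((isUnitary_rangeGate L).one_kronecker _).one_kronecker _)).mul
    (IsUnitary.idle hc).idle

end UnitaryScheme

/-! ### The encoded blocks -/

section Blocks

variable {N D M : ℕ} {A : Matrix (Fin N) (Fin N) ℝ} {L : Labelling A D M}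
  {S : ℕ} [NeZero S] {Sc Sr : ℕ} (O : Oracles L S Sc Sr) {p : ℝ}

/-- Postselecting all flags of `V_r · O_rg · V_c` on `0` composes the accepted blocks of `V_c` and
`V_r` through the in-range labels. -/
lemma combine_apply {Fc Fr : Type*} [Fintype Fc] [Fintype Fr] [DecidableEq Fc] [DecidableEq Fr]
    [Zero Fc] [Zero Fr]
    (Vr : Matrix (Fr × Fin N × Fin S) (Fr × Fin D × Fin M) ℂ)
    (Vc : Matrix (Fc × Fin D × Fin M) (Fc × Fin N × Fin S) ℂ) (i j : Fin N) :
    combine L Vr Vc (0, 0, 0, i, 0) (0, 0, 0, j, 0) =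
      ∑ x ∈ L.inRange, Vr (0, i, 0) (0, x) * Vc (0, x) (0, j, 0) := by
  have h1 : ∀ (f : Fc) (g : Fr) (e : Fin 2) (y : Fin D × Fin M),
      ((1 : Matrix Fc Fc ℂ) ⊗ₖ idle (Fin 2) Vr * (1 : Matrix Fc Fc ℂ) ⊗ₖ
        ((1 : Matrix Fr Fr ℂ) ⊗ₖ rangeGate L)) (0, 0, 0, i, 0) (f, g, e, y) =
      if f = 0 then Vr (0, i, 0) (g, y) * rangeGate L (0, y) (e, y) else 0 := by
    intro f g e y
    rw [← mul_kronecker_mul, kroneckerMap_apply, Matrix.one_mul, Matrix.one_apply]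
    simp only [eq_comm (a := (0 : Fc))]
    split_ifs with hf
    · rw [one_mul, Matrix.mul_apply, Fintype.sum_prod_type, Finset.sum_eq_single g,
        Fintype.sum_prod_type, Finset.sum_eq_single 0, Finset.sum_eq_single y]
      · simp [idle, kroneckerMap_apply]
      · intro z _ hz
        simp [idle, kroneckerMap_apply, rangeGate, hz]
      · simp
      · intro e' _ he
        apply Finset.sum_eq_zero
        intro z _
        simp [idle, Ne.symm he]
      · simp
      · intro g' _ hg
        apply Finset.sum_eq_zero
        rintro ⟨e', z⟩ _
        simp [idle, kroneckerMap_apply, hg]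
      · simp
    · simp
  rw [combine, Matrix.mul_apply, Fintype.sum_prod_type, Finset.sum_eq_single 0,
    Fintype.sum_prod_type, Finset.sum_eq_single 0, Fintype.sum_prod_type, Finset.sum_eq_single 0]
  · rw [← Finset.sum_subset (Finset.subset_univ L.inRange)]
    · apply Finset.sum_congr rfl
      intro x hx
      rw [h1]
      simp [idle, rangeGate, hx]
    · intro x _ hx
      rw [h1]
      simp [rangeGate, hx]
  · intro e _ he
    apply Finset.sum_eq_zero
    intro z _
    simp [idle, he]
  · simp
  · intro e _ he
    apply Finset.sum_eq_zero
    intro z _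
    simp [idle, he]
  · simp
  · intro e _ he
    apply Finset.sum_eq_zero
    rintro ⟨g, e', z⟩ _
    rw [h1]
    simp [he]
  · simp

lemma firstBlock_eq_ite (x : Fin D × Fin M) (j : Fin N) :
    firstBlock O p x j = if x ∈ L.inRange then firstHalf O p (0, x) (0, j, 0) else 0 := by
  rw [firstBlock, Matrix.mul_apply, Fintype.sum_prod_type, Finset.sum_eq_single 0,
    Fintype.sum_prod_type, Finset.sum_eq_single 0, Finset.sum_eq_single x]
  · by_cases hx : x ∈ L.inRange <;> simp [idle, kroneckerMap_apply, rangeGate, hx]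
  · intro y _ hy
    simp [idle, kroneckerMap_apply, rangeGate, Ne.symm hy]
  · simp
  · intro e _ he
    apply Finset.sum_eq_zero
    intro z _
    simp [idle, he]
  · simp
  · intro e _ he
    apply Finset.sum_eq_zero
    intro z _
    simp [kroneckerMap_apply, Ne.symm he]
  · simp

lemma secondBlock_eq_ite (i : Fin N) (x : Fin D × Fin M) :
    secondBlock O p i x = if x ∈ L.inRange then secondHalf O p (0, i, 0) (0, x) else 0 := by
  rw [secondBlock, Matrix.mul_apply, Fintype.sum_prod_type, Finset.sum_eq_single 0,
    Fintype.sum_prod_type, Finset.sum_eq_single 0, Finset.sum_eq_single x]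
  · by_cases hx : x ∈ L.inRange <;> simp [idle, kroneckerMap_apply, rangeGate, hx]
  · intro y _ hy
    simp [idle, kroneckerMap_apply, rangeGate, hy]
  · simp
  · intro e _ he
    apply Finset.sum_eq_zero
    intro z _
    simp [idle, Ne.symm he]
  · simp
  · intro e _ he
    apply Finset.sum_eq_zero
    intro z _
    simp [kroneckerMap_apply, he]
  · simp

lemma rot_zero_zero {x : ℝ} (h₁ : -1 ≤ x) (h₂ : x ≤ 1) : rot x 0 0 = x := by
  simp only [rot, rotX, Matrix.of_apply, Matrix.cons_val_zero]
  rw [mul_div_cancel_left₀ _ (two_ne_zero), Real.cos_arccos h₁ h₂]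

lemma rpow_le_dataMax {q : ℝ} (d : Fin D) : |L.val d| ^ q ≤ dataMax L q :=
  le_ciSup (f := fun d => |L.val d| ^ q) (Set.finite_range _).bddAbove d

lemma dataMax_pos {q : ℝ} (d : Fin D) : 0 < dataMax L q :=
  (Real.rpow_pos_of_pos (abs_pos.mpr (L.val_ne_zero d)) q).trans_le (rpow_le_dataMax d)

lemma dataMax_mul {q r : ℝ} (hq : 0 ≤ q) (hr : 0 ≤ r) [Nonempty (Fin D)] :
    dataMax L q * dataMax L r = dataMax L (q + r) := by
  obtain ⟨d, hd⟩ := Finite.exists_max fun d => |L.val d|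
  have h : ∀ q, 0 ≤ q → dataMax L q = |L.val d| ^ q := by
    intro q hq
    refine le_antisymm (ciSup_le fun e => ?_) (rpow_le_dataMax d)
    exact Real.rpow_le_rpow (abs_nonneg _) (hd e) hq
  rw [h q hq, h r hr, h _ (add_nonneg hq hr),
    Real.rpow_add (abs_pos.mpr (L.val_ne_zero d))]

lemma abs_sign_mul (a : ℝ) (ha : a ≠ 0) : |Real.sign a| = 1 := by
  rcases Real.sign_apply_eq_of_ne_zero a ha with h | h <;> simp [h]

/-- An in-range label `x` has `O_c`-amplitude on `|j⟩ H|0⟩` equal to `Sc^(-1/2)` if `x` lies in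
column `j`, and `0` otherwise. -/
lemma firstHalf_apply {x : Fin D × Fin M} (hx : x ∈ L.inRange) (j : Fin N) :
    firstHalf O p (0, x) (0, j, 0) = if L.col x = j then
      ((Real.sign (L.val x.1) * |L.val x.1| ^ p / (Real.sqrt Sc * dataMax L p) : ℝ) : ℂ) else 0 := by
  obtain ⟨s, hs, hO⟩ := O.Oc_spec x hx
  have hpos := dataMax_pos (L := L) (q := p) x.1
  have hrot : rot (Real.sign (L.val x.1) * |L.val x.1| ^ p / dataMax L p) 0 0 =
      ((Real.sign (L.val x.1) * |L.val x.1| ^ p / dataMax L p : ℝ) : ℂ) := by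
    have : |Real.sign (L.val x.1) * |L.val x.1| ^ p / dataMax L p| ≤ 1 := by
      rw [abs_div, abs_mul, abs_sign_mul _ (L.val_ne_zero _), one_mul, abs_of_pos hpos,
        abs_of_nonneg (by positivity), div_le_one hpos]
      exact rpow_le_dataMax _
    exact rot_zero_zero (abs_le.mp this).1 (abs_le.mp this).2
  rw [firstHalf, Matrix.mul_assoc, ← mul_kronecker_mul, Matrix.mul_apply, Fintype.sum_prod_type,
    Finset.sum_eq_single 0, Finset.sum_eq_single x]
  · rw [kroneckerMap_apply, Matrix.one_mul, Matrix.mul_apply, Finset.sum_eq_single (L.col x, s)]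
    · simp only [multiplexedRot, if_true, hrot, Matrix.conjTranspose_apply, hO,
        kroneckerMap_apply, O.Hc_spec, if_pos hs, Matrix.one_apply]
      split_ifs
      · push_cast
        simp
        ring
      · simp
    · intro y _ hy
      simp [hO, hy]
    · simp
  · intro y _ hy
    simp [multiplexedRot, Ne.symm hy]
  · simp
  · intro e _ he
    apply Finset.sum_eq_zero
    intro z _
    simp [kroneckerMap_apply, he]
  · simp

lemma secondHalf_apply {x : Fin D × Fin M} (hx : x ∈ L.inRange) (i : Fin N) :
    secondHalf O p (0, i, 0) (0, x) = if L.row x = i then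
      ((|L.val x.1| ^ (1 - p) / (Real.sqrt Sr * dataMax L (1 - p)) : ℝ) : ℂ) else 0 := by
  obtain ⟨s, hs, hO⟩ := O.Or_spec x hx
  have hpos := dataMax_pos (L := L) (q := 1 - p) x.1
  have hrot : rot (|L.val x.1| ^ (1 - p) / dataMax L (1 - p)) 0 0 =
      ((|L.val x.1| ^ (1 - p) / dataMax L (1 - p) : ℝ) : ℂ) := by
    refine rot_zero_zero ((by norm_num : (-1 : ℝ) ≤ 0).trans (by positivity)) ?_
    rw [div_le_one hpos]
    exact rpow_le_dataMax _
  rw [secondHalf, ← mul_kronecker_mul, Matrix.mul_apply, Fintype.sum_prod_type,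
    Finset.sum_eq_single 0, Finset.sum_eq_single x]
  · rw [kroneckerMap_apply, Matrix.one_mul, Matrix.mul_apply, Finset.sum_eq_single (L.row x, s)]
    · simp only [multiplexedRot, if_true, hrot, Matrix.conjTranspose_apply, hO,
        kroneckerMap_apply, O.Hr_spec, if_pos hs, Matrix.one_apply, eq_comm (a := i)]
      split_ifs
      · push_cast
        simp
        ring
      · simp
    · intro y _ hy
      simp [hO, hy]
    · simp
  · intro y _ hy
    simp [multiplexedRot, hy]
  · simp
  · intro e _ he
    apply Finset.sum_eq_zero
    intro z _
    simp [kroneckerMap_apply, Ne.symm he]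
  · simp

end Blocks

/-! ### Singular value transformation -/

section SVT

variable {α β : Type*} [Fintype α] [Fintype β] [DecidableEq α] [DecidableEq β]

/-- The signal reflection `[[x, √(1-x²)], [√(1-x²), -x]]`. -/
noncomputable def reflection (x : ℝ) : Matrix (Fin 2) (Fin 2) ℂ :=
  !![(x : ℂ), (Real.sqrt (1 - x ^ 2) : ℂ); (Real.sqrt (1 - x ^ 2) : ℂ), -(x : ℂ)]

/-- The alternating product of phase gates and signal reflections, whose upper left entry has the
real part `svtPolynomial`. -/
noncomputable def reflectionSequence (x φ : ℝ) (l : List (ℝ × ℝ)) : Matrix (Fin 2) (Fin 2) ℂ :=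
  phaseSequence (reflection x) (fun k : Fin 2 => k = 0) (fun k : Fin 2 => k = 0) φ l

lemma svtPolynomial_eq_re (Φ : Phases) (x : ℝ) :
    svtPolynomial Φ x = (reflectionSequence x Φ.1 Φ.2 0 0).re := rfl

lemma reflection_conjTranspose (x : ℝ) : (reflection x)ᴴ = reflection x := by
  ext i j
  fin_cases i <;> fin_cases j <;> simp [reflection, Matrix.conjTranspose_apply]

lemma reflectionSequence_nil_zero (x φ : ℝ) :
    reflectionSequence x φ [] 0 0 = Complex.exp (Complex.I * φ) * x := by
  simp [reflectionSequence, phaseSequence, phaseGate, reflection, Matrix.diagonal_mul]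

lemma reflectionSequence_nil_one (x φ : ℝ) :
    reflectionSequence x φ [] 1 0 =
      Complex.exp (-(Complex.I * φ)) * (Real.sqrt (1 - x ^ 2) : ℝ) := by
  simp [reflectionSequence, phaseSequence, phaseGate, reflection, Matrix.diagonal_mul]

lemma reflectionSequence_cons_zero (x φ : ℝ) (a : ℝ × ℝ) (l : List (ℝ × ℝ)) :
    reflectionSequence x φ (a :: l) 0 0 = Complex.exp (Complex.I * φ) *
      (x * (Complex.exp (Complex.I * a.1) * (x * reflectionSequence x a.2 l 0 0
          + (Real.sqrt (1 - x ^ 2) : ℝ) * reflectionSequence x a.2 l 1 0))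
        + (Real.sqrt (1 - x ^ 2) : ℝ) * (Complex.exp (-(Complex.I * a.1)) *
          ((Real.sqrt (1 - x ^ 2) : ℝ) * reflectionSequence x a.2 l 0 0
          - x * reflectionSequence x a.2 l 1 0))) := by
  rw [reflectionSequence, phaseSequence, reflection_conjTranspose, ← reflectionSequence]
  simp only [Matrix.mul_assoc, Matrix.mul_apply, Fin.sum_univ_two, phaseGate]
  simp [reflection]
  ring

lemma reflectionSequence_cons_one (x φ : ℝ) (a : ℝ × ℝ) (l : List (ℝ × ℝ)) :
    reflectionSequence x φ (a :: l) 1 0 = Complex.exp (-(Complex.I * φ)) *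
      ((Real.sqrt (1 - x ^ 2) : ℝ) * (Complex.exp (Complex.I * a.1) *
          (x * reflectionSequence x a.2 l 0 0
          + (Real.sqrt (1 - x ^ 2) : ℝ) * reflectionSequence x a.2 l 1 0))
        - x * (Complex.exp (-(Complex.I * a.1)) *
          ((Real.sqrt (1 - x ^ 2) : ℝ) * reflectionSequence x a.2 l 0 0
          - x * reflectionSequence x a.2 l 1 0))) := by
  rw [reflectionSequence, phaseSequence, reflection_conjTranspose, ← reflectionSequence]
  simp only [Matrix.mul_assoc, Matrix.mul_apply, Fin.sum_univ_two, phaseGate]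
  simp [reflection]
  ring

/-- An overall phase of the upper left entry can be absorbed into the first rotation. -/
lemma reflectionSequence_add_zero (x φ ψ : ℝ) (l : List (ℝ × ℝ)) :
    reflectionSequence x (φ + ψ) l 0 0 =
      Complex.exp (Complex.I * ψ) * reflectionSequence x φ l 0 0 := by
  have h : Complex.exp (Complex.I * (φ + ψ : ℝ)) =
      Complex.exp (Complex.I * ψ) * Complex.exp (Complex.I * φ) := by
    rw [← Complex.exp_add]
    push_cast
    ring_nf
  cases l with
  | nil => rw [reflectionSequence_nil_zero, reflectionSequence_nil_zero, h, mul_assoc]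
  | cons a l => rw [reflectionSequence_cons_zero, reflectionSequence_cons_zero, h, mul_assoc]

lemma reflectionSequence_neg (x : ℝ) (l : List (ℝ × ℝ)) : ∀ φ : ℝ,
    reflectionSequence x (-φ) (l.map fun a => (-a.1, -a.2)) 0 0 =
      star (reflectionSequence x φ l 0 0) ∧
    reflectionSequence x (-φ) (l.map fun a => (-a.1, -a.2)) 1 0 =
      star (reflectionSequence x φ l 1 0) := by
  induction l with
  | nil =>
    intro φ
    rw [List.map_nil, reflectionSequence_nil_zero, reflectionSequence_nil_zero,
      reflectionSequence_nil_one, reflectionSequence_nil_one]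
    constructor <;> simp [← Complex.exp_conj]
  | cons a l ih =>
    intro φ
    obtain ⟨h0, h1⟩ := ih a.2
    rw [List.map_cons, reflectionSequence_cons_zero, reflectionSequence_cons_zero,
      reflectionSequence_cons_one, reflectionSequence_cons_one]
    simp only [h0, h1]
    constructor <;> simp [← Complex.exp_conj]

lemma phaseGate_mulVec_of_support {P : α → Prop} [DecidablePred P] (φ : ℝ) {v : α → ℂ}
    (hv : ∀ x, ¬ P x → v x = 0) :
    phaseGate P φ *ᵥ v = Complex.exp (Complex.I * φ) • v := by
  ext x
  by_cases h : P x <;> simp [phaseGate, mulVec_diagonal, h, hv]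

lemma phaseGate_mulVec_of_vanish {P : α → Prop} [DecidablePred P] (φ : ℝ) {v : α → ℂ}
    (hv : ∀ x, P x → v x = 0) :
    phaseGate P φ *ᵥ v = Complex.exp (-(Complex.I * φ)) • v := by
  ext x
  by_cases h : P x <;> simp [phaseGate, mulVec_diagonal, h, hv]

/-- Let `v` and `w` be a pair of singular vectors of the accepted block of `U`, with singular value
`ζ`. Then `U` maps the span of `v` and `U† w - ζ v` to the span of `w` and `U v - ζ w`, where it
acts as the reflection with parameter `ζ` (up to the normalisation `√(1-ζ²)` of the second vectors,
which may vanish), so that the phase sequence of `U` acts on `v` like the first column of the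
reflection sequence. No normalisation of `v` and `w` is used, and `w = 0` is allowed if `ζ = 0`. -/
lemma phaseSequence_mulVec {U : Matrix β α ℂ} (hU : IsUnitary U) {P' : β → Prop} {P : α → Prop}
    [DecidablePred P'] [DecidablePred P] {v : α → ℂ} {w : β → ℂ} {ζ : ℝ} (hζ : ζ ^ 2 ≤ 1)
    (hv : ∀ x, ¬ P x → v x = 0) (hw : ∀ y, ¬ P' y → w y = 0)
    (hUv : ∀ y, P' y → (U *ᵥ v) y = ζ * w y) (hUw : ∀ x, P x → (Uᴴ *ᵥ w) x = ζ * v x)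
    (l : List (ℝ × ℝ)) : ∀ φ, ∃ c : ℂ,
      reflectionSequence ζ φ l 1 0 = (Real.sqrt (1 - ζ ^ 2) : ℝ) * c ∧
      phaseSequence U P' P φ l *ᵥ v =
        reflectionSequence ζ φ l 0 0 • w + c • (U *ᵥ v - (ζ : ℂ) • w) := by
  have hs : ((Real.sqrt (1 - ζ ^ 2) : ℝ) : ℂ) ^ 2 = 1 - (ζ : ℂ) ^ 2 := by
    rw [← Complex.ofReal_pow, Real.sq_sqrt (by linarith)]; push_cast; ring
  have hw' : ∀ y, P' y → (U *ᵥ v - (ζ : ℂ) • w) y = 0 := by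
    intro y hy; simp [hUv y hy]
  have hv' : ∀ x, P x → (Uᴴ *ᵥ w - (ζ : ℂ) • v) x = 0 := by
    intro x hx; simp [hUw x hx]
  have hUU : ∀ u, U *ᵥ (Uᴴ *ᵥ u) = u := by
    intro u; rw [mulVec_mulVec, hU.1, one_mulVec]
  have hUU' : ∀ u, Uᴴ *ᵥ (U *ᵥ u) = u := by
    intro u; rw [mulVec_mulVec, hU.2, one_mulVec]
  induction l with
  | nil =>
    intro φ
    refine ⟨Complex.exp (-(Complex.I * φ)), ?_, ?_⟩
    · rw [reflectionSequence_nil_one, mul_comm]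
    · have : U *ᵥ v = (ζ : ℂ) • w + (U *ᵥ v - (ζ : ℂ) • w) := by abel
      rw [phaseSequence, ← mulVec_mulVec]
      conv_lhs => rw [this]
      rw [mulVec_add, mulVec_smul, phaseGate_mulVec_of_support _ hw,
        phaseGate_mulVec_of_vanish _ hw', reflectionSequence_nil_zero, smul_smul, mul_comm]
  | cons a l ih =>
    intro φ
    obtain ⟨c, hc, hseq⟩ := ih a.2
    set r := reflectionSequence ζ a.2 l 0 0
    -- the components along `v` and `U† w - ζ v` after the first `U†`
    set f : ℂ := ζ * r + (1 - (ζ : ℂ) ^ 2) * c with hf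
    set g : ℂ := r - ζ * c with hg
    have h1 : Uᴴ *ᵥ (r • w + c • (U *ᵥ v - (ζ : ℂ) • w)) =
        f • v + g • (Uᴴ *ᵥ w - (ζ : ℂ) • v) := by
      rw [mulVec_add, mulVec_smul, mulVec_smul, mulVec_sub, mulVec_smul, hUU', hf, hg]
      module
    set e := Complex.exp (Complex.I * a.1)
    set e' := Complex.exp (-(Complex.I * a.1))
    have h2 : U *ᵥ (e • f • v + e' • g • (Uᴴ *ᵥ w - (ζ : ℂ) • v)) =
        (ζ * (e * f) + (1 - (ζ : ℂ) ^ 2) * (e' * g)) • w +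
          (e * f - ζ * (e' * g)) • (U *ᵥ v - (ζ : ℂ) • w) := by
      rw [mulVec_add, mulVec_smul, mulVec_smul, mulVec_smul, mulVec_smul, mulVec_sub, mulVec_smul,
        hUU]
      module
    refine ⟨Complex.exp (-(Complex.I * φ)) * (e * f - ζ * (e' * g)), ?_, ?_⟩
    · rw [reflectionSequence_cons_one, hc, hf, hg]
      linear_combination Complex.exp (-(Complex.I * φ)) *
        (Real.sqrt (1 - ζ ^ 2) : ℝ) * e * c * hs
    · rw [phaseSequence, ← mulVec_mulVec, hseq, ← mulVec_mulVec, h1, ← mulVec_mulVec, mulVec_add,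
        mulVec_smul, mulVec_smul, phaseGate_mulVec_of_support _ hv,
        phaseGate_mulVec_of_vanish _ hv', smul_comm f, smul_comm g, ← mulVec_mulVec, h2,
        mulVec_add, mulVec_smul, mulVec_smul, phaseGate_mulVec_of_support _ hw,
        phaseGate_mulVec_of_vanish _ hw', smul_smul, smul_smul, mul_comm _ (Complex.exp _),
        mul_comm _ (Complex.exp _)]
      congr 2
      rw [reflectionSequence_cons_zero, hc, hf, hg]
      linear_combination Complex.exp (Complex.I * φ) * (-(ζ : ℂ) * e * c - e' * (r - ζ * c)) * hs

lemma phaseSequence_mulVec_apply {U : Matrix β α ℂ} (hU : IsUnitary U) {P' : β → Prop}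
    {P : α → Prop} [DecidablePred P'] [DecidablePred P] {v : α → ℂ} {w : β → ℂ} {ζ : ℝ}
    (hζ : ζ ^ 2 ≤ 1) (hv : ∀ x, ¬ P x → v x = 0) (hw : ∀ y, ¬ P' y → w y = 0)
    (hUv : ∀ y, P' y → (U *ᵥ v) y = ζ * w y) (hUw : ∀ x, P x → (Uᴴ *ᵥ w) x = ζ * v x)
    (φ : ℝ) (l : List (ℝ × ℝ)) {y : β} (hy : P' y) :
    (phaseSequence U P' P φ l *ᵥ v) y = reflectionSequence ζ φ l 0 0 * w y := by
  obtain ⟨c, -, h⟩ := phaseSequence_mulVec hU hζ hv hw hUv hUw l φ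
  rw [h]
  simp [hUv y hy]

lemma hadamard_sandwich (X Y : Matrix β α ℂ) (b : β) (a : α) :
    ((hadamard ⊗ₖ (1 : Matrix β β ℂ))
    * (Matrix.of fun (a : Fin 2 × β) (b : Fin 2 × α) => if a.1 = b.1 then
        (if a.1 = 0 then X a.2 b.2 else Y a.2 b.2) else 0)
    * (hadamard ⊗ₖ (1 : Matrix α α ℂ))) (0, b) (0, a) = (X b a + Y b a) / 2 := by
  have hs : ((Real.sqrt 2 : ℝ) : ℂ) ^ 2 = 2 := by
    rw [← Complex.ofReal_pow, Real.sq_sqrt (by norm_num)]; norm_num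
  have h0 : ((Real.sqrt 2 : ℝ) : ℂ) ≠ 0 := by
    intro h; rw [h] at hs; norm_num at hs
  simp only [Matrix.mul_apply, Fintype.sum_prod_type, Fin.sum_univ_two, kroneckerMap_apply,
    hadamard, Matrix.one_apply]
  simp
  field_simp
  rw [hs]
  ring

/-- The accepted block of the singular value transformation circuit, applied to a right singular
vector `v`, is `svtPolynomial` of the singular value times the left singular vector `w`. -/
lemma svtCircuit_apply {U : Matrix β α ℂ} (hU : IsUnitary U) {P' : β → Prop}
    {P : α → Prop} [DecidablePred P'] [DecidablePred P] {v : α → ℂ} {w : β → ℂ} {ζ : ℝ}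
    (hζ : ζ ^ 2 ≤ 1) (hv : ∀ x, ¬ P x → v x = 0) (hw : ∀ y, ¬ P' y → w y = 0)
    (hUv : ∀ y, P' y → (U *ᵥ v) y = ζ * w y) (hUw : ∀ x, P x → (Uᴴ *ᵥ w) x = ζ * v x)
    (Φ : Phases) {y : β} (hy : P' y) :
    ∑ x, svtCircuit U P' P Φ (0, y) (0, x) * v x = svtPolynomial Φ ζ * w y := by
  have h1 := phaseSequence_mulVec_apply hU hζ hv hw hUv hUw Φ.1 Φ.2 hy
  have h2 := phaseSequence_mulVec_apply hU hζ hv hw hUv hUw Φ.opp.1 Φ.opp.2 hy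
  rw [Phases.opp, (reflectionSequence_neg ζ Φ.2 Φ.1).1] at h2
  have h3 : ((svtPolynomial Φ ζ : ℝ) : ℂ) = (reflectionSequence ζ Φ.1 Φ.2 0 0 +
      star (reflectionSequence ζ Φ.1 Φ.2 0 0)) / 2 := by
    rw [svtPolynomial_eq_re, Complex.re_eq_add_conj]; rfl
  calc ∑ x, svtCircuit U P' P Φ (0, y) (0, x) * v x
      = ((phaseSequence U P' P Φ.1 Φ.2 *ᵥ v) y
          + (phaseSequence U P' P Φ.opp.1 Φ.opp.2 *ᵥ v) y) / 2 := by
        simp only [mulVec, dotProduct, ← Finset.sum_add_distrib, Finset.sum_div]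
        refine Finset.sum_congr rfl fun x _ => ?_
        rw [svtCircuit, hadamard_sandwich]
        ring
    _ = svtPolynomial Φ ζ * w y := by
        rw [h1, Phases.opp, h2, h3]
        ring

end SVT

section SVTBlock

variable {α β ι : Type*} [Fintype α] [Fintype β] [DecidableEq α] [DecidableEq β] [Fintype ι]
  [DecidableEq ι]

/-- If the accepted block of `U` has the singular value decomposition `∑ᵢ ζᵢ |wᵢ⟩⟨vᵢ|`, then the
accepted block of the singular value transformation circuit is `∑ᵢ P(ζᵢ) |wᵢ⟩⟨vᵢ|`, summed over the
indices with `ζᵢ ≠ 0`. -/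
theorem svtCircuit_block {U : Matrix β α ℂ} (hU : IsUnitary U) {P' : β → Prop}
    {P : α → Prop} [DecidablePred P'] [DecidablePred P] {v : ι → α → ℂ} {w : ι → β → ℂ}
    {ζ : ι → ℝ} (hζ : ∀ i, ζ i ^ 2 ≤ 1)
    (hv : ∀ i, ζ i ≠ 0 → ∀ x, ¬ P x → v i x = 0) (hw : ∀ i, ζ i ≠ 0 → ∀ y, ¬ P' y → w i y = 0)
    (hvv : ∀ i j, ∑ x, star (v i x) * v j x = if i = j then 1 else 0)
    (hww : ∀ i j, ∑ y, star (w i y) * w j y = if i = j then 1 else 0)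
    (hblock : ∀ y x, P' y → P x → U y x = ∑ i, ζ i * w i y * star (v i x))
    (Φ : Phases) {y : β} {x : α} (hy : P' y) (hx : P x) :
    svtCircuit U P' P Φ (0, y) (0, x) =
      ∑ i, (if ζ i = 0 then 0 else (svtPolynomial Φ (ζ i) : ℂ)) * w i y * star (v i x) := by
  have hUv : ∀ i, ζ i ≠ 0 → ∀ y, P' y → (U *ᵥ v i) y = ζ i * w i y := by
    intro i hi y hy
    calc (U *ᵥ v i) y = ∑ x, (∑ k, ζ k * w k y * star (v k x)) * v i x := by
          refine Finset.sum_congr rfl fun x _ => ?_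
          change U y x * v i x = _
          by_cases hx : P x
          · rw [hblock y x hy hx]
          · rw [hv i hi x hx, mul_zero, mul_zero]
      _ = ∑ k, ζ k * w k y * ∑ x, star (v k x) * v i x := by
          simp only [Finset.sum_mul, Finset.mul_sum]
          rw [Finset.sum_comm]
          exact Finset.sum_congr rfl fun k _ => Finset.sum_congr rfl fun x _ => by ring
      _ = ζ i * w i y := by simp only [hvv]; simp
  have hUw : ∀ i, ζ i ≠ 0 → ∀ x, P x → (Uᴴ *ᵥ w i) x = ζ i * v i x := by
    intro i hi x hx
    calc (Uᴴ *ᵥ w i) x = ∑ y, (∑ k, ζ k * star (w k y) * v k x) * w i y := by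
          refine Finset.sum_congr rfl fun y _ => ?_
          change Uᴴ x y * w i y = _
          by_cases hy : P' y
          · rw [Matrix.conjTranspose_apply, hblock y x hy hx, star_sum]
            congr 1
            refine Finset.sum_congr rfl fun k _ => ?_
            simp
          · rw [hw i hi y hy, mul_zero, mul_zero]
      _ = ∑ k, ζ k * v k x * ∑ y, star (w k y) * w i y := by
          simp only [Finset.sum_mul, Finset.mul_sum]
          rw [Finset.sum_comm]
          exact Finset.sum_congr rfl fun k _ => Finset.sum_congr rfl fun y _ => by ring
      _ = ζ i * v i x := by simp only [hww]; simp
  -- decompose the basis vector at `x` into right singular vectors and a vector in the kernel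
  set T : Finset ι := Finset.univ.filter fun i => ζ i ≠ 0 with hT
  set z : α → ℂ := Pi.single x 1 - ∑ i ∈ T, star (v i x) • v i with hz
  have hzP : ∀ a, ¬ P a → z a = 0 := by
    intro a ha
    have hax : a ≠ x := by rintro rfl; exact ha hx
    rw [hz, Pi.sub_apply, Pi.single_eq_of_ne hax, zero_sub, neg_eq_zero, Finset.sum_apply]
    refine Finset.sum_eq_zero fun i hi => ?_
    rw [Pi.smul_apply, hv i (Finset.mem_filter.mp hi).2 a ha, smul_zero]
  have hzU : ∀ y, P' y → (U *ᵥ z) y = (0 : ℝ) * (0 : β → ℂ) y := by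
    intro y hy
    rw [hz, mulVec_sub, mulVec_single_one, mulVec_sum, Pi.sub_apply, Finset.sum_apply,
      Matrix.col_apply, hblock y x hy hx, hT, Finset.sum_filter, ← Finset.sum_sub_distrib]
    rw [Finset.sum_eq_zero]
    · simp
    · intro i _
      by_cases hi : ζ i = 0
      · simp [hi]
      · rw [if_pos hi, mulVec_smul, Pi.smul_apply, hUv i hi y hy, smul_eq_mul]
        ring
  have hz0 : ∑ a, svtCircuit U P' P Φ (0, y) (0, a) * z a = 0 := by
    have := svtCircuit_apply hU (ζ := 0) (w := 0) (by norm_num) hzP (fun _ _ => rfl) hzU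
      (fun _ _ => by simp) Φ hy
    simpa using this
  have hvi : ∀ i ∈ T, ∑ a, svtCircuit U P' P Φ (0, y) (0, a) * v i a =
      svtPolynomial Φ (ζ i) * w i y := by
    intro i hi
    have hi := (Finset.mem_filter.mp hi).2
    exact svtCircuit_apply hU (hζ i) (hv i hi) (hw i hi) (hUv i hi) (hUw i hi) Φ hy
  have hsplit : ∀ a, (Pi.single x 1 : α → ℂ) a = z a + ∑ i ∈ T, star (v i x) * v i a := by
    intro a
    simp [hz]
  calc svtCircuit U P' P Φ (0, y) (0, x)
      = ∑ a, svtCircuit U P' P Φ (0, y) (0, a) * (Pi.single x 1 : α → ℂ) a := by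
        simp [Pi.single_apply]
    _ = ∑ a, svtCircuit U P' P Φ (0, y) (0, a) * z a +
          ∑ i ∈ T, star (v i x) * ∑ a, svtCircuit U P' P Φ (0, y) (0, a) * v i a := by
        simp only [hsplit, mul_add, Finset.sum_add_distrib, Finset.mul_sum]
        congr 1
        rw [Finset.sum_comm]
        exact Finset.sum_congr rfl fun k _ => Finset.sum_congr rfl fun y _ => by ring
    _ = ∑ i ∈ T, star (v i x) * (svtPolynomial Φ (ζ i) * w i y) := by
        rw [hz0, zero_add]
        exact Finset.sum_congr rfl fun i hi => by rw [hvi i hi]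
    _ = _ := by
        rw [hT, Finset.sum_filter]
        refine Finset.sum_congr rfl fun i _ => ?_
        by_cases hi : ζ i = 0
        · simp [hi]
        · simp only [hi, ne_eq, not_false_eq_true, if_true, if_false]
          ring

end SVTBlock

/-! ### Polynomials that are nonnegative on the unit interval -/

section Lukacs

open Polynomial

lemma mul_mem_degreeLT {R : Type*} [CommRing R] {u f : R[X]} {m n r : ℕ}
    (hu : u.natDegree ≤ m) (hf : f ∈ degreeLT R n) (h : m + n ≤ r) : u * f ∈ degreeLT R r := by
  rw [mem_degreeLT] at hf ⊢
  rcases n with _ | n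
  · have : f = 0 := by
      rw [← degree_eq_bot, ← Nat.WithBot.lt_zero_iff]
      exact_mod_cast hf
    rw [this, mul_zero, degree_zero]
    exact WithBot.bot_lt_coe _
  · have hf' : f.degree ≤ n := by
      rw [degree_le_iff_coeff_zero]
      rw [degree_lt_iff_coeff_zero] at hf
      exact fun i hi => hf i (by exact_mod_cast hi)
    refine ((degree_mul_le u f).trans (add_le_add (natDegree_le_iff_degree_le.mp hu) hf')).trans_lt ?_
    exact_mod_cast (by omega : m + n < r)

/-- The weighted sums of squares `a² + X (1 - X) b²` of degree at most `n = 2 k`, and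
`X a² + (1 - X) b²` of degree at most `n = 2 k + 1`. -/
def LukacsForm (n : ℕ) (g : ℝ[X]) : Prop :=
  (∃ (k : ℕ) (a b : ℝ[X]), n = 2 * k ∧ a ∈ degreeLT ℝ (k + 1) ∧ b ∈ degreeLT ℝ k ∧
    g = a ^ 2 + X * (1 - X) * b ^ 2) ∨
  (∃ (k : ℕ) (a b : ℝ[X]), n = 2 * k + 1 ∧ a ∈ degreeLT ℝ (k + 1) ∧ b ∈ degreeLT ℝ (k + 1) ∧
    g = X * a ^ 2 + (1 - X) * b ^ 2)

lemma natDegree_one_sub_X_le : (1 - X : ℝ[X]).natDegree ≤ 1 := by compute_degree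

/-- The even forms are norms from `ℝ[X][√(-X (1 - X))]`, and the odd ones become norms after
multiplication by `X`; this is why products of forms are forms. A linear factor which is nonnegative
on `[0, 1]` is an odd form with constant `a` and `b`. -/
lemma LukacsForm.mul_linear {n : ℕ} {g : ℝ[X]} (hg : LukacsForm n g) {α β : ℝ} (hα : 0 ≤ α)
    (hβ : 0 ≤ β) : LukacsForm (n + 1) (g * (C α * X + C β * (1 - X))) := by
  obtain ⟨c, rfl⟩ : ∃ c, α = c ^ 2 := ⟨√α, (Real.sq_sqrt hα).symm⟩
  obtain ⟨d, rfl⟩ : ∃ d, β = d ^ 2 := ⟨√β, (Real.sq_sqrt hβ).symm⟩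
  have hd : (C d * (1 - X) : ℝ[X]).natDegree ≤ 1 := by compute_degree
  have hc : (C c * X : ℝ[X]).natDegree ≤ 1 := by compute_degree
  have hd' : (C d : ℝ[X]).natDegree ≤ 0 := by compute_degree
  have hc' : (C c : ℝ[X]).natDegree ≤ 0 := by compute_degree
  rcases hg with ⟨k, a, b, rfl, ha, hb, rfl⟩ | ⟨k, a, b, rfl, ha, hb, rfl⟩
  · refine Or.inr ⟨k, C c * a + C d * (1 - X) * b, C d * a - C c * X * b, rfl, ?_, ?_, ?_⟩
    · exact add_mem (mul_mem_degreeLT hc' ha (by omega)) (mul_mem_degreeLT hd hb (by omega))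
    · exact sub_mem (mul_mem_degreeLT hd' ha (by omega)) (mul_mem_degreeLT hc hb (by omega))
    · simp only [C_pow]; ring
  · refine Or.inl ⟨k + 1, C c * X * a + C d * (1 - X) * b, C d * a - C c * b, by ring, ?_, ?_, ?_⟩
    · exact add_mem (mul_mem_degreeLT hc ha (by omega)) (mul_mem_degreeLT hd hb (by omega))
    · exact sub_mem (mul_mem_degreeLT hd' ha (by omega)) (mul_mem_degreeLT hc' hb (by omega))
    · simp only [C_pow]; ring

/-- The quadratic factor is an even form with constant `b`. -/
lemma LukacsForm.mul_quadratic {n : ℕ} {g : ℝ[X]} (hg : LukacsForm n g) {u : ℝ[X]}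
    (hu : u.natDegree ≤ 1) (e : ℝ) :
    LukacsForm (n + 2) (g * (u ^ 2 + X * (1 - X) * C e ^ 2)) := by
  have h2 : (X * (1 - X) * C e : ℝ[X]).natDegree ≤ 2 := by compute_degree
  have h1 : ((1 - X) * C e : ℝ[X]).natDegree ≤ 1 := by compute_degree
  have h1' : (X * C e : ℝ[X]).natDegree ≤ 1 := by compute_degree
  have h0 : (C e : ℝ[X]).natDegree ≤ 0 := by compute_degree
  rcases hg with ⟨k, a, b, rfl, ha, hb, rfl⟩ | ⟨k, a, b, rfl, ha, hb, rfl⟩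
  · refine Or.inl ⟨k + 1, u * a - X * (1 - X) * C e * b, C e * a + u * b, by ring, ?_, ?_, by ring⟩
    · exact sub_mem (mul_mem_degreeLT hu ha (by omega)) (mul_mem_degreeLT h2 hb (by omega))
    · exact add_mem (mul_mem_degreeLT h0 ha (by omega)) (mul_mem_degreeLT hu hb (by omega))
  · refine Or.inr ⟨k + 1, u * a + (1 - X) * C e * b, u * b - X * C e * a, by ring, ?_, ?_, by ring⟩
    · exact add_mem (mul_mem_degreeLT hu ha (by omega)) (mul_mem_degreeLT h1 hb (by omega))
    · exact sub_mem (mul_mem_degreeLT hu hb (by omega)) (mul_mem_degreeLT h1' ha (by omega))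

lemma LukacsForm.succ {n : ℕ} {g : ℝ[X]} (hg : LukacsForm n g) : LukacsForm (n + 1) g := by
  have := hg.mul_linear zero_le_one zero_le_one
  simpa using this

/-- A quadratic polynomial which is nonnegative on `[0, 1]` and positive at the end points is of
the form `(q₀ (1 - X) - q₁ X)² + e² X (1 - X)`. -/
lemma exists_quadratic_form {q : ℝ[X]} (hdeg : q.natDegree ≤ 2)
    (hq : ∀ t ∈ Set.Icc (0 : ℝ) 1, 0 ≤ q.eval t) (h0 : 0 < q.eval 0) (h1 : 0 < q.eval 1) :
    ∃ (u : ℝ[X]) (e : ℝ), u.natDegree ≤ 1 ∧ q = u ^ 2 + X * (1 - X) * C e ^ 2 := by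
  obtain ⟨c, b, a, rfl⟩ : ∃ c b a : ℝ, q = C c + C b * X + C a * X ^ 2 := by
    refine ⟨q.coeff 0, q.coeff 1, q.coeff 2, ?_⟩
    conv_lhs => rw [q.as_sum_range_C_mul_X_pow' (n := 3) (by omega)]
    simp [Finset.sum_range_succ]
  simp only [eval_add, eval_C, eval_mul, eval_X, eval_pow] at hq h0 h1
  obtain ⟨r, hr, hr2⟩ : ∃ r > 0, r ^ 2 = c := by
    refine ⟨√c, Real.sqrt_pos.mpr (by linarith), Real.sq_sqrt (by linarith)⟩
  obtain ⟨s, hs, hs2⟩ : ∃ s > 0, s ^ 2 = c + b + a := by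
    refine ⟨√(c + b + a), Real.sqrt_pos.mpr (by linarith), Real.sq_sqrt (by linarith)⟩
  -- the linear term `r (1 - X) - s X` vanishes at `r / (r + s)`
  have hrs : 0 < r + s := by positivity
  have ht := hq (r / (r + s)) ⟨by positivity, by rw [div_le_one hrs]; linarith⟩
  have hb : b = s ^ 2 - c - a := by linarith
  have hkey : 0 ≤ (r + s) ^ 2 - a := by
    subst hb
    have : c + (s ^ 2 - c - a) * (r / (r + s)) + a * (r / (r + s)) ^ 2 =
        r * s * (r ^ 2 + s ^ 2 - a + 2 * r * s) / (r + s) ^ 2 := by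
      rw [← hr2]; field_simp; ring
    rw [this] at ht
    have h3 : 0 ≤ r ^ 2 + s ^ 2 - a + 2 * r * s := by
      by_contra hneg
      push Not at hneg
      have : r * s * (r ^ 2 + s ^ 2 - a + 2 * r * s) / (r + s) ^ 2 < 0 :=
        div_neg_of_neg_of_pos (mul_neg_of_pos_of_neg (by positivity) hneg) (by positivity)
      linarith
    linarith [add_sq r s]
  refine ⟨C r * (1 - X) - C s * X, √((r + s) ^ 2 - a), by compute_degree, ?_⟩
  have he : √((r + s) ^ 2 - a) ^ 2 = (r + s) ^ 2 - a := Real.sq_sqrt hkey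
  rw [← C_pow, he, hb, ← hr2]
  simp only [C_sub, C_pow, C_add]
  ring

/-- Nonnegativity on `[0, 1]` extends to a single exceptional point. -/
lemma eval_nonneg_of_ne {g : ℝ[X]} (r : ℝ)
    (h : ∀ t ∈ Set.Icc (0 : ℝ) 1, t ≠ r → 0 ≤ g.eval t) :
    ∀ t ∈ Set.Icc (0 : ℝ) 1, 0 ≤ g.eval t := by
  intro t ht
  by_contra hneg
  push Not at hneg
  have hopen : IsOpen {s | g.eval s < 0} := isOpen_lt g.continuous continuous_const
  have hcl : t ∈ closure (Set.Ioo (0 : ℝ) 1) := by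
    rw [closure_Ioo (by norm_num)]; exact ht
  have hne := mem_closure_iff.mp hcl _ hopen hneg
  obtain ⟨s₀, hs₀⟩ := hne
  have hinf : ({s | g.eval s < 0} ∩ Set.Ioo (0 : ℝ) 1).Infinite :=
    infinite_of_mem_nhds s₀ ((hopen.inter isOpen_Ioo).mem_nhds hs₀)
  obtain ⟨s, hs, hsr⟩ := hinf.exists_notMem_finset {r}
  have := h s ⟨hs.2.1.le, hs.2.2.le⟩ (by simpa using hsr)
  exact absurd hs.1 (by simpa using this)

/-- The Markov–Lukács theorem: every real polynomial of degree at most `n` which is nonnegative on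
`[0, 1]` is a weighted sum of squares as above. The proof splits off irreducible factors. -/
theorem lukacsForm_of_nonneg (n : ℕ) : ∀ g : ℝ[X], g.natDegree ≤ n →
    (∀ t ∈ Set.Icc (0 : ℝ) 1, 0 ≤ g.eval t) → LukacsForm n g := by
  induction n using Nat.strong_induction_on with
  | _ n ih =>
  intro g hdeg hg
  rcases Nat.eq_zero_or_pos n with rfl | hn
  · obtain ⟨c, rfl⟩ : ∃ c, g = C c := ⟨_, eq_C_of_natDegree_le_zero hdeg⟩
    have hc : 0 ≤ c := by simpa using hg 0 (by simp)
    refine Or.inl ⟨0, C (√c), 0, rfl, ?_, zero_mem _, ?_⟩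
    · rw [mem_degreeLT]
      exact degree_C_le.trans_lt (by norm_num)
    · rw [← C_pow, Real.sq_sqrt hc]; simp
  obtain ⟨n, rfl⟩ : ∃ m, n = m + 1 := ⟨n - 1, by omega⟩
  by_cases hlow : g.natDegree ≤ n
  · exact (ih n (by omega) g hlow hg).succ
  have hdeg' : g.natDegree = n + 1 := by omega
  have hg0 : g ≠ 0 := by
    rintro rfl; simp at hdeg'
  -- a quadratic factor `q` with quotient `g'` of degree `n - 1`
  have hquad : ∀ q g' : ℝ[X], g = g' * q → q.natDegree = 2 →
      (∀ t ∈ Set.Icc (0 : ℝ) 1, 0 ≤ q.eval t) → 0 < q.eval 0 → 0 < q.eval 1 →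
      (∃ r, ∀ t ∈ Set.Icc (0 : ℝ) 1, t ≠ r → 0 < q.eval t) → LukacsForm (n + 1) g := by
    rintro q g' rfl hq2 hq h0 h1 ⟨r, hr⟩
    obtain ⟨u, e, hu, hqe⟩ := exists_quadratic_form hq2.le hq h0 h1
    have hd := natDegree_mul (left_ne_zero_of_mul hg0) (right_ne_zero_of_mul hg0)
    have hn1 : n - 1 + 2 = n + 1 := by omega
    have hg' : LukacsForm (n - 1) g' := by
      refine ih (n - 1) (by omega) g' (by omega) (eval_nonneg_of_ne r fun t ht htr => ?_)
      have := hg t ht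
      rw [eval_mul] at this
      exact nonneg_of_mul_nonneg_left this (hr t ht htr)
    have := hg'.mul_quadratic hu e
    rwa [hn1, ← hqe] at this
  -- a linear factor which is nonnegative on `[0, 1]`
  have hlin : ∀ (α β r : ℝ) (g' : ℝ[X]), 0 ≤ α → 0 ≤ β →
      g = g' * (C α * X + C β * (1 - X)) →
      (∀ t ∈ Set.Icc (0 : ℝ) 1, t ≠ r → 0 < α * t + β * (1 - t)) → g'.natDegree ≤ n →
      LukacsForm (n + 1) g := by
    rintro α β r g' hα hβ rfl hr hd
    refine (ih n (by omega) g' hd (eval_nonneg_of_ne r fun t ht htr => ?_)).mul_linear hα hβ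
    have := hg t ht
    rw [eval_mul] at this
    refine nonneg_of_mul_nonneg_left this ?_
    simpa using hr t ht htr
  by_cases hroot : ∃ r, g.IsRoot r
  · obtain ⟨r, hr⟩ := hroot
    obtain ⟨g', hg'⟩ := dvd_iff_isRoot.mpr hr
    have hd' : g'.natDegree ≤ n := by
      have := natDegree_mul (left_ne_zero_of_mul (hg' ▸ hg0)) (right_ne_zero_of_mul (hg' ▸ hg0))
      rw [← hg', natDegree_X_sub_C] at this
      omega
    rcases le_or_gt r 0 with hr0 | hr0
    · refine hlin (1 - r) (-r) r g' (by linarith) (by linarith) ?_ ?_ hd'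
      · rw [hg']
        simp only [C_sub, C_neg, C_1]
        ring
      · intro t ht htr
        have := lt_of_le_of_ne (hr0.trans ht.1) (Ne.symm htr)
        linarith
    rcases le_or_gt 1 r with hr1 | hr1
    · refine hlin (r - 1) r r (-g') (by linarith) (by linarith) ?_ ?_ (by rwa [natDegree_neg])
      · rw [hg']
        simp only [C_sub, C_1]
        ring
      · intro t ht htr
        have := lt_of_le_of_ne (ht.2.trans hr1) htr
        linarith
    -- an interior root is a minimum, hence a double root
    have hmin : IsLocalMin (fun t => g.eval t) r := by
      filter_upwards [Icc_mem_nhds hr0 hr1] with t ht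
      rw [show g.eval r = 0 from hr]
      exact hg t ht
    have hder : g.derivative.IsRoot r := by
      have := hmin.deriv_eq_zero
      rwa [Polynomial.deriv] at this
    have hmul : 2 ≤ g.rootMultiplicity r :=
      (one_lt_rootMultiplicity_iff_isRoot hg0).mpr ⟨hr, hder⟩
    obtain ⟨g₂, hg₂⟩ := (le_rootMultiplicity_iff hg0).mp hmul
    refine hquad ((X - C r) ^ 2) g₂ (by rw [hg₂]; ring) ?_ ?_ ?_ ?_ ⟨r, ?_⟩
    · rw [natDegree_pow, natDegree_X_sub_C]
    · intro t _
      simp only [eval_pow, eval_sub, eval_X, eval_C]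
      positivity
    · simp only [eval_pow, eval_sub, eval_X, eval_C]
      have : (0 - r) ≠ 0 := by linarith
      positivity
    · simp only [eval_pow, eval_sub, eval_X, eval_C]
      have : (1 - r) ≠ 0 := by linarith
      positivity
    · intro t _ ht
      simp only [eval_pow, eval_sub, eval_X, eval_C]
      have : (t - r) ≠ 0 := sub_ne_zero.mpr ht
      positivity
  · push Not at hroot
    have hunit : ¬ IsUnit g := by
      intro h
      have := natDegree_eq_zero_of_isUnit h
      omega
    obtain ⟨q, hqirr, hqdvd⟩ := WfDvdMonoid.exists_irreducible_factor hunit hg0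
    have hqroot : ∀ t, q.eval t ≠ 0 := by
      intro t h
      obtain ⟨g', rfl⟩ := hqdvd
      exact hroot t (by simp [IsRoot, h])
    have hq2 : q.natDegree = 2 := by
      have h2 : q.natDegree ≤ 2 := hqirr.natDegree_le_two
      have hpos := hqirr.natDegree_pos
      by_contra hne
      have h1 : q.degree = 1 := degree_eq_iff_natDegree_eq_of_pos one_pos |>.mpr (by omega)
      obtain ⟨t, ht⟩ := exists_root_of_degree_eq_one h1
      exact hqroot t ht
    -- up to its sign, the factor is positive
    obtain ⟨q', hq'dvd, hq'2, hq'⟩ : ∃ q' : ℝ[X], q' ∣ g ∧ q'.natDegree = 2 ∧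
        ∀ t, 0 < q'.eval t := by
      have hsign : (∀ t, 0 < q.eval t) ∨ ∀ t, q.eval t < 0 := by
        by_contra hcon
        push Not at hcon
        obtain ⟨⟨s, hs⟩, ⟨t, ht⟩⟩ := hcon
        obtain ⟨z, hz⟩ := mem_range_of_exists_le_of_exists_ge q.continuous ⟨s, hs⟩ ⟨t, ht⟩
        exact hqroot z hz
      rcases hsign with h | h
      · exact ⟨q, hqdvd, hq2, h⟩
      · exact ⟨-q, (neg_dvd).mpr hqdvd, by rwa [natDegree_neg], fun t => by simpa using h t⟩
    obtain ⟨g', hg'⟩ := hq'dvd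
    exact hquad q' g' (by rw [hg', mul_comm]) hq'2 (fun t _ => (hq' t).le) (hq' 0) (hq' 1)
      ⟨0, fun t _ _ => hq' t⟩

end Lukacs

/-! ### Phases for a given polynomial -/

section SignalProcessing

open Polynomial

/-- The polynomial with complex conjugate coefficients. -/
noncomputable def conjPoly (f : ℂ[X]) : ℂ[X] := f.map (starRingEnd ℂ)

lemma conjPoly_add (f g : ℂ[X]) : conjPoly (f + g) = conjPoly f + conjPoly g :=
  Polynomial.map_add _

lemma conjPoly_sub (f g : ℂ[X]) : conjPoly (f - g) = conjPoly f - conjPoly g :=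
  Polynomial.map_sub _

lemma conjPoly_mul (f g : ℂ[X]) : conjPoly (f * g) = conjPoly f * conjPoly g :=
  Polynomial.map_mul _

lemma conjPoly_X : conjPoly X = X := map_X _

lemma conjPoly_C (c : ℂ) : conjPoly (C c) = C (star c) := map_C _

lemma star_exp_I_mul (φ : ℝ) :
    star (Complex.exp (Complex.I * φ)) = Complex.exp (-(Complex.I * φ)) := by
  simp [← Complex.exp_conj]

lemma star_exp_neg_I_mul (φ : ℝ) :
    star (Complex.exp (-(Complex.I * φ))) = Complex.exp (Complex.I * φ) := by
  simp [← Complex.exp_conj]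

lemma exp_mul_exp_neg (φ : ℝ) :
    Complex.exp (Complex.I * φ) * Complex.exp (-(Complex.I * φ)) = 1 := by
  rw [← Complex.exp_add]; simp

lemma C_exp_mul_C_exp_neg (φ : ℝ) :
    (C (Complex.exp (Complex.I * φ)) * C (Complex.exp (-(Complex.I * φ))) : ℂ[X]) = 1 := by
  rw [← C_mul, exp_mul_exp_neg, C_1]

lemma exists_eq_exp_of_mul_star {z : ℂ} (hz : z * star z = 1) :
    ∃ φ : ℝ, z = Complex.exp (Complex.I * φ) := by
  have h : ‖z‖ = 1 := by
    have h1 : ‖z‖ * ‖z‖ = 1 := by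
      have := congrArg norm hz
      rwa [norm_mul, norm_star, norm_one] at this
    nlinarith [norm_nonneg z]
  refine ⟨Complex.arg z, ?_⟩
  conv_lhs => rw [← Complex.norm_mul_exp_arg_mul_I z]
  rw [h, mul_comm Complex.I]
  simp

/-- Two complex numbers of the same modulus are aligned by opposite rotations. -/
lemma exists_phase {z w : ℂ} (h : z * star z = w * star w) :
    ∃ φ : ℝ, Complex.exp (-(Complex.I * φ)) * z = Complex.exp (Complex.I * φ) * w := by
  by_cases hw : w = 0
  · subst hw
    have : z = 0 := by simpa using h
    exact ⟨0, by simp [this]⟩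
  · obtain ⟨θ, hθ⟩ := exists_eq_exp_of_mul_star (z := z / w) (by
      have hw' : star w ≠ 0 := star_ne_zero.mpr hw
      rw [star_div₀]
      field_simp
      exact h)
    refine ⟨θ / 2, ?_⟩
    rw [div_eq_iff hw] at hθ
    rw [hθ, ← mul_assoc, ← Complex.exp_add]
    congr 2
    push_cast
    ring

lemma natDegree_le_of_mem_degreeLT {f : ℂ[X]} {k : ℕ} (hf : f ∈ degreeLT ℂ (k + 1)) :
    f.natDegree ≤ k := by
  rw [mem_degreeLT, degree_lt_iff_coeff_zero] at hf
  exact natDegree_le_iff_coeff_eq_zero.mpr fun i hi => hf i (by omega)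

lemma coeff_eq_zero_of_mem_degreeLT {f : ℂ[X]} {k : ℕ} (hf : f ∈ degreeLT ℂ k) :
    f.coeff k = 0 := by
  rw [mem_degreeLT, degree_lt_iff_coeff_zero] at hf
  exact hf k le_rfl

lemma mem_degreeLT_of_coeff_eq_zero {f : ℂ[X]} {k : ℕ} (hf : f ∈ degreeLT ℂ (k + 1))
    (h : f.coeff k = 0) : f ∈ degreeLT ℂ k := by
  rw [mem_degreeLT, degree_lt_iff_coeff_zero] at hf ⊢
  intro i hi
  rcases hi.eq_or_lt with rfl | hi
  · exact h
  · exact hf i hi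

lemma coeff_mul_conjPoly {f : ℂ[X]} {k : ℕ} (hf : f ∈ degreeLT ℂ (k + 1)) :
    (f * conjPoly f).coeff (2 * k) = f.coeff k * star (f.coeff k) := by
  have h := natDegree_le_of_mem_degreeLT hf
  rw [two_mul, conjPoly, coeff_mul_add_eq_of_natDegree_le h (natDegree_map_le.trans h), coeff_map]
  rfl

lemma mul_conjPoly_mem_degreeLT {f : ℂ[X]} {k : ℕ} (hf : f ∈ degreeLT ℂ k) :
    f * conjPoly f ∈ degreeLT ℂ (2 * k - 1) := by
  rcases k with _ | k
  · simp only [mem_degreeLT] at hf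
    have : f = 0 := by
      rw [← degree_eq_bot, ← Nat.WithBot.lt_zero_iff]
      exact_mod_cast hf
    rw [this, zero_mul]
    exact zero_mem _
  · have h := natDegree_le_of_mem_degreeLT hf
    rw [mem_degreeLT, degree_lt_iff_coeff_zero]
    intro i hi
    refine coeff_eq_zero_of_natDegree_lt (lt_of_le_of_lt (natDegree_mul_le_of_le h
      (natDegree_map_le.trans h)) (by omega))

/-- Stripping one rotation and one reflection off a column `(x a(x²), √(1-x²) b(x²))` of odd
degree: the phase cancels the leading coefficients. -/
lemma strip_odd {k : ℕ} {a b : ℂ[X]} (ha : a ∈ degreeLT ℂ (k + 1)) (hb : b ∈ degreeLT ℂ (k + 1))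
    (hN : X * (a * conjPoly a) + (1 - X) * (b * conjPoly b) = 1) :
    ∃ (φ : ℝ) (a' b' : ℂ[X]), a' ∈ degreeLT ℂ (k + 1) ∧ b' ∈ degreeLT ℂ k ∧
      a' * conjPoly a' + X * (1 - X) * (b' * conjPoly b') = 1 ∧
      a = C (Complex.exp (Complex.I * φ)) * (a' + (1 - X) * b') ∧
      b = C (Complex.exp (-(Complex.I * φ))) * (a' - X * b') := by
  have hlead : a.coeff k * star (a.coeff k) = b.coeff k * star (b.coeff k) := by
    have h := congrArg (fun f => coeff f (2 * k + 1)) hN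
    have hb0 := coeff_eq_zero_of_mem_degreeLT (k := 2 * k + 1)
      (by simpa [mul_add] using mul_conjPoly_mem_degreeLT hb)
    simp only [coeff_add, coeff_X_mul, sub_mul, one_mul, coeff_sub, coeff_mul_conjPoly ha,
      coeff_mul_conjPoly hb, hb0, coeff_one] at h
    simp at h
    exact sub_eq_zero.mp (by simpa [sub_eq_add_neg] using h)
  obtain ⟨φ, hφ⟩ := exists_phase hlead
  have hee := C_exp_mul_C_exp_neg φ
  have hs := star_exp_I_mul φ
  have hs' := star_exp_neg_I_mul φ
  set e := Complex.exp (Complex.I * φ)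
  set e' := Complex.exp (-(Complex.I * φ))
  have hb' : C e' * a - C e * b ∈ degreeLT ℂ k := by
    refine mem_degreeLT_of_coeff_eq_zero (sub_mem (mul_mem_degreeLT (natDegree_C _).le ha (by omega))
      (mul_mem_degreeLT (natDegree_C _).le hb (by omega))) ?_
    simp [hφ]
  refine ⟨φ, X * (C e' * a - C e * b) + C e * b, C e' * a - C e * b, ?_, hb', ?_, ?_, ?_⟩
  · exact add_mem (mul_mem_degreeLT natDegree_X_le hb' (by omega))
      (mul_mem_degreeLT (natDegree_C _).le hb (by omega))
  · simp only [conjPoly_add, conjPoly_sub, conjPoly_mul, conjPoly_X, conjPoly_C, hs, hs']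
    linear_combination (X * (a * conjPoly a) + (1 - X) * (b * conjPoly b)) * hee + hN
  · linear_combination (-a) * hee
  · linear_combination (-b) * hee

/-- Stripping one rotation and one reflection off a column `(a(x²), √(1-x²) x b(x²))` of even
degree. -/
lemma strip_even {k : ℕ} {a b : ℂ[X]} (ha : a ∈ degreeLT ℂ (k + 2)) (hb : b ∈ degreeLT ℂ (k + 1))
    (hN : a * conjPoly a + X * (1 - X) * (b * conjPoly b) = 1) :
    ∃ (φ : ℝ) (a' b' : ℂ[X]), a' ∈ degreeLT ℂ (k + 1) ∧ b' ∈ degreeLT ℂ (k + 1) ∧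
      X * (a' * conjPoly a') + (1 - X) * (b' * conjPoly b') = 1 ∧
      a = C (Complex.exp (Complex.I * φ)) * (X * a' + (1 - X) * b') ∧
      b = C (Complex.exp (-(Complex.I * φ))) * (a' - b') := by
  have hlead : a.coeff (k + 1) * star (a.coeff (k + 1)) = b.coeff k * star (b.coeff k) := by
    have h := congrArg (fun f => coeff f (2 * k + 1 + 1)) hN
    have hb0 := coeff_eq_zero_of_mem_degreeLT (k := 2 * k + 1)
      (by simpa [mul_add] using mul_conjPoly_mem_degreeLT hb)
    have ha0 := coeff_mul_conjPoly ha
    rw [show 2 * (k + 1) = 2 * k + 1 + 1 by ring] at ha0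
    simp only [coeff_add, mul_assoc X, coeff_X_mul, sub_mul, one_mul, coeff_sub, ha0,
      coeff_mul_conjPoly hb, hb0, coeff_one] at h
    simp at h
    exact sub_eq_zero.mp (by simpa [sub_eq_add_neg] using h)
  obtain ⟨φ, hφ⟩ := exists_phase hlead
  have hee := C_exp_mul_C_exp_neg φ
  have hs := star_exp_I_mul φ
  have hs' := star_exp_neg_I_mul φ
  set e := Complex.exp (Complex.I * φ)
  set e' := Complex.exp (-(Complex.I * φ))
  have hbk := coeff_eq_zero_of_mem_degreeLT hb
  have hb' : C e' * a - C e * X * b ∈ degreeLT ℂ (k + 1) := by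
    refine mem_degreeLT_of_coeff_eq_zero (sub_mem (mul_mem_degreeLT (natDegree_C _).le ha (by omega))
      (mul_mem_degreeLT (m := 1) (by compute_degree) hb (by omega))) ?_
    simp [hφ, mul_assoc]
  refine ⟨φ, C e' * a - C e * X * b + C e * b, C e' * a - C e * X * b, ?_, hb', ?_, ?_, ?_⟩
  · exact add_mem hb' (mul_mem_degreeLT (natDegree_C _).le hb (by omega))
  · simp only [conjPoly_add, conjPoly_sub, conjPoly_mul, conjPoly_X, conjPoly_C, hs, hs']
    linear_combination (a * conjPoly a + X * (1 - X) * (b * conjPoly b)) * hee + hN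
  · linear_combination (-a) * hee
  · linear_combination (-b) * hee

/-- Every normalised column `(x a(x²), √(1-x²) b(x²))` is the first column of a reflection sequence
of length `2 k + 1`, up to a constant phase. -/
lemma exists_reflectionSequence (k : ℕ) : ∀ a b : ℂ[X], a ∈ degreeLT ℂ (k + 1) →
    b ∈ degreeLT ℂ (k + 1) → X * (a * conjPoly a) + (1 - X) * (b * conjPoly b) = 1 →
    ∃ (ψ φ : ℝ) (l : List (ℝ × ℝ)), l.length = k ∧ ∀ x : ℝ, x ^ 2 ≤ 1 →
      Complex.exp (Complex.I * ψ) * reflectionSequence x φ l 0 0 = x * a.eval ((x : ℂ) ^ 2) ∧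
      Complex.exp (Complex.I * ψ) * reflectionSequence x φ l 1 0 =
        (Real.sqrt (1 - x ^ 2) : ℝ) * b.eval ((x : ℂ) ^ 2) := by
  induction k with
  | zero =>
    intro a b ha hb hN
    obtain ⟨φ, a', b', ha', hb', hN', rfl, rfl⟩ := strip_odd ha hb hN
    obtain rfl : b' = 0 := by
      rw [mem_degreeLT] at hb'
      rw [← degree_eq_bot, ← Nat.WithBot.lt_zero_iff]
      exact_mod_cast hb'
    obtain ⟨c, rfl⟩ : ∃ c, a' = C c :=
      ⟨_, eq_C_of_natDegree_le_zero (natDegree_le_of_mem_degreeLT ha')⟩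
    rw [conjPoly_C, ← C_mul, zero_mul, mul_zero, add_zero, ← C_1, C_inj] at hN'
    obtain ⟨ψ, rfl⟩ := exists_eq_exp_of_mul_star hN'
    refine ⟨ψ, φ, [], rfl, fun x _ => ⟨?_, ?_⟩⟩
    · rw [reflectionSequence_nil_zero]; simp; ring
    · rw [reflectionSequence_nil_one]; simp; ring
  | succ k ih =>
    intro a b ha hb hN
    obtain ⟨φ₁, a₁, b₁, ha₁, hb₁, hN₁, rfl, rfl⟩ := strip_odd ha hb hN
    obtain ⟨φ₂, a₂, b₂, ha₂, hb₂, hN₂, rfl, rfl⟩ := strip_even ha₁ hb₁ hN₁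
    obtain ⟨ψ, φ₃, l, hl, h⟩ := ih a₂ b₂ ha₂ hb₂ hN₂
    refine ⟨ψ, φ₁, (φ₂, φ₃) :: l, by simp [hl], fun x hx => ?_⟩
    obtain ⟨h0, h1⟩ := h x hx
    have hs : ((Real.sqrt (1 - x ^ 2) : ℝ) : ℂ) ^ 2 = 1 - (x : ℂ) ^ 2 := by
      rw [← Complex.ofReal_pow, Real.sq_sqrt (by linarith)]; push_cast; ring
    rw [reflectionSequence_cons_zero, reflectionSequence_cons_one]
    simp only [eval_mul, eval_add, eval_sub, eval_C, eval_X, eval_one]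
    set s := ((Real.sqrt (1 - x ^ 2) : ℝ) : ℂ)
    set u := Complex.exp (Complex.I * ψ)
    set e₁ := Complex.exp (Complex.I * φ₁)
    set e₂ := Complex.exp (Complex.I * φ₂)
    set e₁' := Complex.exp (-(Complex.I * φ₁))
    set e₂' := Complex.exp (-(Complex.I * φ₂))
    set r₀ := reflectionSequence x φ₃ l 0 0
    set r₁ := reflectionSequence x φ₃ l 1 0
    set A := a₂.eval ((x : ℂ) ^ 2)
    set B := b₂.eval ((x : ℂ) ^ 2)
    constructor
    · linear_combination e₁ * (x * e₂ * x + s * e₂' * s) * h0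
        + e₁ * (x * e₂ * s - s * e₂' * x) * h1
        + e₁ * (x * e₂ * B + e₂' * x * (A - B)) * hs
    · linear_combination e₁' * (s * e₂ * x - x * e₂' * s) * h0
        + e₁' * (s * e₂ * s + x * e₂' * x) * h1 + e₁' * e₂ * s * B * hs

/-- Every odd real polynomial `x E(x²)` of degree at most `2 k + 1` which is bounded by `1` on
`[-1, 1]` is implemented by `2 k + 1` phases: `1 - t E(t)²` is a weighted sum of squares, which
provides the imaginary part and the second component of a normalised column. -/
theorem exists_phases {k : ℕ} {E : ℝ[X]} (hE : E.natDegree ≤ k)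
    (hb : ∀ t ∈ Set.Icc (0 : ℝ) 1, t * E.eval t ^ 2 ≤ 1) :
    ∃ Φ : Phases, Φ.uses = 2 * k + 1 ∧
      ∀ x : ℝ, x ^ 2 ≤ 1 → svtPolynomial Φ x = x * E.eval (x ^ 2) := by
  have hdeg : (1 - X * E ^ 2 : ℝ[X]).natDegree ≤ 2 * k + 1 := by
    refine (natDegree_sub_le _ _).trans (max_le (by simp) ?_)
    refine natDegree_mul_le.trans ?_
    have := natDegree_pow_le (p := E) (n := 2)
    have := natDegree_X_le (R := ℝ)
    omega
  have hform := lukacsForm_of_nonneg (2 * k + 1) (1 - X * E ^ 2) hdeg (by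
    intro t ht
    have := hb t ht
    simp
    linarith)
  rcases hform with ⟨j, a, b, hj, -⟩ | ⟨j, a, b, hj, ha, hb', hab⟩
  · omega
  obtain rfl : j = k := by omega
  have hmap : ∀ f : ℝ[X], f ∈ degreeLT ℝ (j + 1) →
      f.map (algebraMap ℝ ℂ) ∈ degreeLT ℂ (j + 1) := by
    intro f hf
    rw [mem_degreeLT] at hf ⊢
    exact degree_map_le.trans_lt hf
  have hconj : ∀ f : ℝ[X], conjPoly (f.map (algebraMap ℝ ℂ)) = f.map (algebraMap ℝ ℂ) := by
    intro f
    rw [conjPoly, Polynomial.map_map]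
    congr 1
    ext x
    simp
  have hEmem : E ∈ degreeLT ℝ (j + 1) := by
    rw [mem_degreeLT]
    exact (natDegree_le_iff_degree_le.mp hE).trans_lt (by exact_mod_cast Nat.lt_succ_self j)
  obtain ⟨ψ, φ, l, hl, h⟩ := exists_reflectionSequence j
    (E.map (algebraMap ℝ ℂ) + C Complex.I * a.map (algebraMap ℝ ℂ)) (b.map (algebraMap ℝ ℂ))
    (add_mem (hmap E hEmem) (mul_mem_degreeLT (natDegree_C _).le (hmap a ha) (by omega)))
    (hmap b hb') (by
      have := congrArg (Polynomial.map (algebraMap ℝ ℂ)) hab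
      simp only [Polynomial.map_add, Polynomial.map_sub, Polynomial.map_mul, Polynomial.map_pow,
        map_X, Polynomial.map_one] at this
      have hI : (C Complex.I : ℂ[X]) ^ 2 = -1 := by
        rw [← C_pow, Complex.I_sq, C_neg, C_1]
      rw [conjPoly_add, conjPoly_mul, hconj, hconj, hconj, conjPoly_C, Complex.star_def,
        Complex.conj_I, C_neg]
      linear_combination (-1) * this - X * (a.map (algebraMap ℝ ℂ)) ^ 2 * hI)
  refine ⟨(φ + ψ, l), by simp [Phases.uses, hl], fun x hx => ?_⟩
  rw [svtPolynomial_eq_re, reflectionSequence_add_zero, (h x hx).1]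
  have hev : ∀ f : ℝ[X], (f.map (algebraMap ℝ ℂ)).eval ((x : ℂ) ^ 2) =
      ((f.eval (x ^ 2) : ℝ) : ℂ) := by
    intro f
    rw [← Complex.ofReal_pow, eval_map, ← Complex.coe_algebraMap, eval₂_at_apply]
  rw [eval_add, eval_mul, eval_C, hev, hev]
  simp

end SignalProcessing

/-! ### Amplification polynomials -/

section Amplification

open Polynomial

/-- The probability of at most `l` successes in `2 l + 1` independent trials, as a polynomial in
the success probability. It switches from `1` to `0` around `1/2`. -/
noncomputable def minorityPoly (l : ℕ) : ℝ[X] :=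
  ∑ j ∈ Finset.range (l + 1), C ((2 * l + 1).choose j : ℝ) * (X ^ j * (1 - X) ^ (2 * l + 1 - j))

lemma natDegree_minorityPoly_le (l : ℕ) : (minorityPoly l).natDegree ≤ 2 * l + 1 := by
  refine natDegree_sum_le_of_forall_le _ _ fun j hj => ?_
  have hj' : j ≤ l := by simpa [Nat.lt_succ_iff] using hj
  refine (natDegree_C_mul_le _ _).trans (natDegree_mul_le.trans ?_)
  have h1 : ((1 - X : ℝ[X]) ^ (2 * l + 1 - j)).natDegree ≤ (2 * l + 1 - j) * 1 :=
    natDegree_pow_le_of_le _ natDegree_one_sub_X_le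
  have h2 : ((X : ℝ[X]) ^ j).natDegree ≤ j := natDegree_X_pow_le j
  omega

lemma eval_minorityPoly (l : ℕ) (u : ℝ) : (minorityPoly l).eval u =
    ∑ j ∈ Finset.range (l + 1), ((2 * l + 1).choose j : ℝ) * (u ^ j * (1 - u) ^ (2 * l + 1 - j)) := by
  simp [minorityPoly, eval_finsetSum]

lemma eval_minorityPoly_add (l : ℕ) (u : ℝ) :
    (minorityPoly l).eval u + (minorityPoly l).eval (1 - u) = 1 := by
  have h := add_pow u (1 - u) (2 * l + 1)
  rw [add_sub_cancel, one_pow, show 2 * l + 1 + 1 = (l + 1) + (l + 1) by ring,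
    Finset.sum_range_add] at h
  refine Eq.trans ?_ h.symm
  rw [eval_minorityPoly, eval_minorityPoly, ← Finset.sum_range_reflect
    (fun x => u ^ (l + 1 + x) * (1 - u) ^ (2 * l + 1 - (l + 1 + x)) *
      ((2 * l + 1).choose (l + 1 + x) : ℝ))]
  congr 1
  · exact Finset.sum_congr rfl fun j _ => by ring
  · refine Finset.sum_congr rfl fun j hj => ?_
    have hj' : j ≤ l := by simpa [Nat.lt_succ_iff] using hj
    have h1 : l + 1 + (l + 1 - 1 - j) = 2 * l + 1 - j := by omega
    have h2 : 2 * l + 1 - (2 * l + 1 - j) = j := by omega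
    rw [h1, h2, Nat.choose_symm (by omega), sub_sub_cancel]
    ring

lemma eval_minorityPoly_nonneg (l : ℕ) {u : ℝ} (h0 : 0 ≤ u) (h1 : u ≤ 1) :
    0 ≤ (minorityPoly l).eval u := by
  rw [eval_minorityPoly]
  have := sub_nonneg.mpr h1
  positivity

lemma eval_minorityPoly_le_one (l : ℕ) {u : ℝ} (h0 : 0 ≤ u) (h1 : u ≤ 1) :
    (minorityPoly l).eval u ≤ 1 := by
  have := eval_minorityPoly_nonneg l (u := 1 - u) (by linarith) (by linarith)
  linarith [eval_minorityPoly_add l u]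

/-- A Chernoff bound. -/
lemma eval_minorityPoly_le (l : ℕ) {u : ℝ} (h0 : 1 / 2 ≤ u) (h1 : u ≤ 1) :
    (minorityPoly l).eval u ≤ (4 * (u * (1 - u))) ^ l := by
  have hv : 0 ≤ 1 - u := by linarith
  rw [eval_minorityPoly, mul_pow]
  have h4 : (4 : ℝ) ^ l = ∑ j ∈ Finset.range (l + 1), ((2 * l + 1).choose j : ℝ) := by
    exact_mod_cast (Nat.sum_range_choose_halfway l).symm
  rw [h4, Finset.sum_mul]
  refine Finset.sum_le_sum fun j hj => ?_
  have hj' : j ≤ l := by simpa [Nat.lt_succ_iff] using hj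
  refine mul_le_mul_of_nonneg_left ?_ (by positivity)
  obtain ⟨i, rfl⟩ := Nat.exists_eq_add_of_le hj'
  have he : 2 * (j + i) + 1 - j = j + (i + i) + 1 := by omega
  calc u ^ j * (1 - u) ^ (2 * (j + i) + 1 - j)
      = (u * (1 - u)) ^ j * ((1 - u) * (1 - u)) ^ i * (1 - u) := by
        rw [he, pow_succ, pow_add, pow_add, mul_pow, mul_pow]; ring
    _ ≤ (u * (1 - u)) ^ j * (u * (1 - u)) ^ i * 1 := by
        gcongr
        · linarith
        · linarith
    _ = (u * (1 - u)) ^ (j + i) := by ring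

lemma nat_mul_sinh_le (m : ℕ) {v : ℝ} (hv : 0 ≤ v) : m * Real.sinh v ≤ Real.sinh (m * v) := by
  induction m with
  | zero => simp
  | succ m ih =>
    have hs : 0 ≤ Real.sinh v := Real.sinh_nonneg_iff.mpr hv
    have hs' : 0 ≤ Real.sinh (m * v) := Real.sinh_nonneg_iff.mpr (by positivity)
    push_cast
    rw [add_mul, one_mul, add_mul, one_mul, Real.sinh_add]
    nlinarith [Real.one_le_cosh v, Real.one_le_cosh (m * v)]

lemma cosh_eq_one_add (θ : ℝ) : Real.cosh θ = 1 + 2 * Real.sinh (θ / 2) ^ 2 := by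
  have h := Real.cosh_two_mul (θ / 2)
  rw [mul_div_cancel₀ _ two_ne_zero, Real.cosh_sq] at h
  linarith

lemma one_add_sq_mul_le_eval_T (m : ℕ) {x : ℝ} (hx : 1 ≤ x) :
    1 + m ^ 2 * (x - 1) ≤ (Chebyshev.T ℝ m).eval x := by
  obtain ⟨θ, hθ, rfl⟩ : ∃ θ, 0 ≤ θ ∧ x = Real.cosh θ :=
    ⟨_, Real.arcosh_nonneg hx, (Real.cosh_arcosh hx).symm⟩
  rw [Chebyshev.T_real_cosh, cosh_eq_one_add, cosh_eq_one_add, Int.cast_natCast, mul_div_assoc]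
  have h1 := nat_mul_sinh_le m (v := θ / 2) (by positivity)
  have h2 : 0 ≤ Real.sinh (θ / 2) := Real.sinh_nonneg_iff.mpr (by positivity)
  have h3 : (m * Real.sinh (θ / 2)) ^ 2 ≤ Real.sinh (m * (θ / 2)) ^ 2 :=
    pow_le_pow_left₀ (by positivity) h1 2
  nlinarith

lemma eval_T_le (m : ℕ) {x r : ℝ} (hr : 0 ≤ r) (hx : 1 ≤ x) (hxr : x ≤ 1 + 2 * r ^ 2) :
    (Chebyshev.T ℝ m).eval x ≤ Real.exp (2 * (m * r)) := by
  obtain ⟨θ, hθ, rfl⟩ : ∃ θ, 0 ≤ θ ∧ x = Real.cosh θ :=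
    ⟨_, Real.arcosh_nonneg hx, (Real.cosh_arcosh hx).symm⟩
  rw [Chebyshev.T_real_cosh, Int.cast_natCast]
  have h2 : 0 ≤ Real.sinh (θ / 2) := Real.sinh_nonneg_iff.mpr (by positivity)
  have h3 : Real.sinh (θ / 2) ≤ r := by
    rw [cosh_eq_one_add] at hxr
    exact abs_le_of_sq_le_sq' (by linarith) hr |>.2
  have h4 : θ / 2 ≤ r := (Real.self_le_sinh_iff.mpr (by positivity)).trans h3
  have h5 : m * θ ≤ 2 * (m * r) := by
    nlinarith [mul_le_mul_of_nonneg_left h4 (Nat.cast_nonneg (α := ℝ) m)]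
  have h6 : 0 ≤ m * θ := by positivity
  calc Real.cosh (m * θ) ≤ Real.exp (m * θ) := by
        rw [Real.cosh_eq]
        have := Real.exp_le_exp.mpr (by linarith : -(m * θ) ≤ m * θ)
        linarith
    _ ≤ _ := Real.exp_le_exp.mpr h5

/-- A polynomial in `t` of degree `O(γ)` with values in `[0, 1]` that is separated from `1/2`, from
below for `t ≤ 3 / (4 γ²)` and from above for `t ≥ 1 / γ²`: a rescaled Chebyshev polynomial, whose
growth outside of `[-1, 1]` begins at `t = 1 / γ²`. -/
lemma exists_separating_poly {γ : ℝ} (hγ : 1 ≤ γ) : ∃ h : ℝ[X], (h.natDegree : ℝ) ≤ 2 * γ ∧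
    (∀ t ∈ Set.Icc (0 : ℝ) 1, h.eval t ∈ Set.Icc (0 : ℝ) 1) ∧
    (∀ t, 0 ≤ t → γ ^ 2 * t ≤ 3 / 4 → h.eval t ≤ 1 / 2 - 1 / 800) ∧
    (∀ t, 1 ≤ γ ^ 2 * t → t ≤ 1 → 1 / 2 + 1 / 800 ≤ h.eval t) := by
  set m := ⌈γ⌉₊
  have hm1 : γ ≤ m := Nat.le_ceil γ
  have hm2 : (m : ℝ) ≤ 2 * γ := by
    have := Nat.ceil_lt_add_one (by linarith : 0 ≤ γ)
    linarith
  have hγ0 : 0 < γ := by linarith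
  set r := γ⁻¹ with hr
  have hr0 : 0 < r := inv_pos.mpr hγ0
  have hr1 : r ≤ 1 := inv_le_one_of_one_le₀ hγ
  have hγr : γ * r = 1 := mul_inv_cancel₀ hγ0.ne'
  have hγr2 : γ ^ 2 * r ^ 2 = 1 := by rw [← mul_pow, hγr, one_pow]
  have hmr : (m : ℝ) * r ≤ 2 := by
    calc (m : ℝ) * r ≤ 2 * γ * r := by gcongr
      _ = 2 := by rw [mul_assoc, hγr, mul_one]
  -- `ℓ` maps `[1/γ², 1]` into `[-1, 1]`. The Chebyshev polynomial of `ℓ` is at most `1` there, at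
  -- least `3/2` for `t ≤ 3 / (4 γ²)`, and at most `exp 4 ≤ 81` throughout; the affine map below
  -- sends `5/4` to `1/2` and `[-1, 81]` into `[0, 1]`.
  set ℓ : ℝ[X] := C (1 + 2 * r ^ 2) - C 2 * X with hℓ
  set h : ℝ[X] := C (1 / 2 + 1 / 160) - C (1 / 200) * (Chebyshev.T ℝ m).comp ℓ with hh
  have heval : ∀ t, h.eval t =
      1 / 2 - ((Chebyshev.T ℝ m).eval (1 + 2 * r ^ 2 - 2 * t) - 5 / 4) / 200 := by
    intro t
    simp only [hh, hℓ, eval_sub, eval_C, eval_mul, eval_comp, eval_X]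
    ring
  have hlow : ∀ t, r ^ 2 ≤ t → t ≤ 1 →
      (Chebyshev.T ℝ m).eval (1 + 2 * r ^ 2 - 2 * t) ∈ Set.Icc (-1 : ℝ) 1 := by
    intro t h1 h2
    exact Chebyshev.eval_T_real_mem_Icc _ ⟨by nlinarith, by linarith⟩
  have hhigh : ∀ t, 0 ≤ t → t ≤ r ^ 2 →
      1 ≤ (Chebyshev.T ℝ m).eval (1 + 2 * r ^ 2 - 2 * t) ∧
      (Chebyshev.T ℝ m).eval (1 + 2 * r ^ 2 - 2 * t) ≤ 81 := by
    intro t h1 h2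
    refine ⟨Chebyshev.one_le_eval_T_real _ (by linarith), ?_⟩
    refine (eval_T_le m hr0.le (by linarith) (by linarith)).trans ?_
    have h3 : Real.exp 1 ≤ 3 := by linarith [Real.exp_one_lt_d9]
    calc Real.exp (2 * (m * r)) ≤ Real.exp (4 * 1) := Real.exp_le_exp.mpr (by linarith)
      _ = Real.exp 1 ^ 4 := by rw [← Real.exp_nat_mul]; norm_num
      _ ≤ 3 ^ 4 := by gcongr
      _ = 81 := by norm_num
  refine ⟨h, ?_, ?_, ?_, ?_⟩
  · refine le_trans ?_ hm2
    have hℓ1 : ℓ.natDegree ≤ 1 := by rw [hℓ]; compute_degree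
    have hT : ((Chebyshev.T ℝ m).comp ℓ).natDegree ≤ m := by
      rw [natDegree_comp, Chebyshev.natDegree_T, Int.natAbs_natCast]
      nlinarith
    have : h.natDegree ≤ m := by
      refine (natDegree_sub_le _ _).trans (max_le (by simp) ?_)
      exact (natDegree_C_mul_le _ _).trans hT
    exact_mod_cast this
  · intro t ht
    rw [heval]
    rcases le_total t (r ^ 2) with h1 | h1
    · have := hhigh t ht.1 h1
      constructor <;> linarith [this.1, this.2]
    · have := hlow t h1 ht.2
      constructor <;> linarith [this.1, this.2]
  · intro t ht0 ht
    rw [heval]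
    have ht' : t ≤ 3 / 4 * r ^ 2 := by
      calc t = γ ^ 2 * t * r ^ 2 := by linear_combination (-t) * hγr2
        _ ≤ 3 / 4 * r ^ 2 := by gcongr
    have h1 := one_add_sq_mul_le_eval_T m (x := 1 + 2 * r ^ 2 - 2 * t) (by nlinarith)
    have h2 : γ ^ 2 * (r ^ 2 / 2) ≤ (m : ℝ) ^ 2 * (1 + 2 * r ^ 2 - 2 * t - 1) := by
      have : r ^ 2 / 2 ≤ 1 + 2 * r ^ 2 - 2 * t - 1 := by linarith
      gcongr
    linarith
  · intro t ht ht1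
    rw [heval]
    have ht' : r ^ 2 ≤ t := by
      calc r ^ 2 = 1 * r ^ 2 := (one_mul _).symm
        _ ≤ γ ^ 2 * t * r ^ 2 := by gcongr
        _ = t := by linear_combination t * hγr2
    linarith [(hlow t ht' ht1).2]

/-- Composing the separating polynomial with a vote of `O(log(γ/ε))` trials gives a
polynomial `E` such that `x ↦ γ x E(x²)` is bounded by `1` and has relative accuracy `ε` for
`(γ x)² ≤ 3/4`. -/
lemma exists_amplification_poly {γ ε : ℝ} (hγ : 1 ≤ γ) (hε : 0 < ε) (hε' : ε < 1 / 2) :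
    ∃ E : ℝ[X], ((2 * E.natDegree + 1 : ℕ) : ℝ) ≤ 1300000 * (γ * Real.log (γ / ε)) ∧
      (∀ t ∈ Set.Icc (0 : ℝ) 1, t * (γ * E.eval t) ^ 2 ≤ 1) ∧
      (∀ t, 0 ≤ t → γ ^ 2 * t ≤ 3 / 4 → |E.eval t - 1| ≤ ε) := by
  obtain ⟨h, hdeg, h01, hlow, hhigh⟩ := exists_separating_poly hγ
  have hγ0 : 0 < γ := by linarith
  set Λ := Real.log (γ / ε) with hΛ
  have hge : 2 ≤ γ / ε := by rw [le_div_iff₀ hε]; linarith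
  have hΛ0 : 0.69 ≤ Λ := by
    have := Real.log_le_log (by norm_num) hge
    linarith [Real.log_two_gt_d9]
  set l := ⌈160000 * Λ⌉₊
  have hl1 : 160000 * Λ ≤ l := Nat.le_ceil _
  have hl2 : (l : ℝ) ≤ 160000 * Λ + 1 := (Nat.ceil_lt_add_one (by linarith)).le
  -- `4 u (1 - u) ≤ 1 - 4 / 800²` if `u` differs from `1/2` by at least `1/800`
  have hpow : ((1 : ℝ) - 1 / 160000) ^ l ≤ ε / γ := by
    calc ((1 : ℝ) - 1 / 160000) ^ l ≤ Real.exp (-(1 / 160000)) ^ l := by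
          refine pow_le_pow_left₀ (by norm_num) ?_ _
          linarith [Real.add_one_le_exp (-(1 / 160000 : ℝ))]
      _ = Real.exp (l * -(1 / 160000)) := (Real.exp_nat_mul _ _).symm
      _ ≤ Real.exp (-Λ) := Real.exp_le_exp.mpr (by linarith)
      _ = ε / γ := by rw [Real.exp_neg, hΛ, Real.exp_log (by positivity), inv_div]
  have htail : ∀ u, 1 / 2 + 1 / 800 ≤ u → u ≤ 1 → (minorityPoly l).eval u ≤ ε / γ := by
    intro u hu hu1
    refine (eval_minorityPoly_le l (by linarith) hu1).trans (le_trans ?_ hpow)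
    refine pow_le_pow_left₀ ?_ ?_ _
    · have : 0 ≤ 1 - u := by linarith
      have : 0 ≤ u := by linarith
      positivity
    · nlinarith
  have hεγ : ε / γ ≤ ε := div_le_self hε.le hγ
  -- the degree is at most `(2 l + 1) · 2 γ`, with `l ≤ 160000 Λ + 1` and `Λ ≥ 0.69`
  refine ⟨(minorityPoly l).comp h, ?_, ?_, ?_⟩
  · have hd : (((minorityPoly l).comp h).natDegree : ℝ) ≤ (2 * l + 1) * (2 * γ) := by
      rw [natDegree_comp]
      push_cast
      gcongr
      exact_mod_cast natDegree_minorityPoly_le l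
    push_cast
    nlinarith
  · intro t ht
    rw [eval_comp]
    have hu := h01 t ht
    have hE0 := eval_minorityPoly_nonneg l hu.1 hu.2
    have hE1 := eval_minorityPoly_le_one l hu.1 hu.2
    rw [mul_pow]
    rcases le_total (γ ^ 2 * t) 1 with h1 | h1
    · have hE2 : (minorityPoly l).eval (h.eval t) ^ 2 ≤ 1 := pow_le_one₀ hE0 hE1
      have : 0 ≤ γ ^ 2 * t := mul_nonneg (sq_nonneg _) ht.1
      nlinarith
    · have h2 := htail _ (hhigh t h1 ht.2) hu.2
      have h3 : γ * (minorityPoly l).eval (h.eval t) ≤ 1 := by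
        calc γ * (minorityPoly l).eval (h.eval t) ≤ γ * (ε / γ) := by gcongr
          _ = ε := by field_simp
          _ ≤ 1 := by linarith
      rw [← mul_pow]
      have h4 := pow_le_one₀ (n := 2) (mul_nonneg hγ0.le hE0) h3
      nlinarith [ht.1, ht.2, mul_nonneg (sub_nonneg.mpr ht.2)
        (sq_nonneg (γ * (minorityPoly l).eval (h.eval t)))]
  · intro t ht0 ht
    rw [eval_comp]
    have ht1 : t ≤ 1 := by nlinarith
    have hu := h01 t ⟨ht0, ht1⟩
    have h1 := hlow t ht0 ht
    have h2 := htail (1 - h.eval t) (by linarith) (by linarith [hu.1])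
    have h3 := eval_minorityPoly_add l (h.eval t)
    have h4 := eval_minorityPoly_le_one l hu.1 hu.2
    rw [abs_le]
    constructor <;> linarith

lemma two_rpow_pow_four : ((2 : ℝ) ^ (-(1 / 4) : ℝ)) ^ 4 = 1 / 2 := by
  rw [← Real.rpow_natCast, ← Real.rpow_mul (by norm_num)]
  norm_num

lemma two_rpow_pos : (0 : ℝ) < (2 : ℝ) ^ (-(1 / 4) : ℝ) := by positivity

lemma two_rpow_sq_le : ((2 : ℝ) ^ (-(1 / 4) : ℝ)) ^ 2 ≤ 3 / 4 := by
  nlinarith [two_rpow_pow_four, sq_nonneg ((2 : ℝ) ^ (-(1 / 4) : ℝ))]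

lemma le_two_rpow : (4 / 5 : ℝ) ≤ (2 : ℝ) ^ (-(1 / 4) : ℝ) := by
  refine le_of_pow_le_pow_left₀ (n := 4) (by norm_num) two_rpow_pos.le ?_
  rw [two_rpow_pow_four]
  norm_num

/-- Amplification by `γ` with relative accuracy `ε`, in `O(γ log(γ/ε))` uses. For `γ ≤ 1` the
polynomial `γ x` itself is admissible. -/
theorem exists_phases_amplification {γ ε : ℝ} (hγ : (2 : ℝ) ^ (-(1 / 4) : ℝ) ≤ γ) (hε : 0 < ε)
    (hε' : ε < 1 / 2) : ∃ Φ : Phases,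
      (∀ x ∈ Set.Icc (0 : ℝ) ((2 : ℝ) ^ (-(1 / 4) : ℝ) / γ),
        |svtPolynomial Φ x - γ * x| ≤ ε * (γ * x)) ∧
      (Φ.uses : ℝ) ≤ 1300000 * (γ * Real.log (γ / ε)) := by
  have hγ0 : 0 < γ := two_rpow_pos.trans_le hγ
  have hx : ∀ x ∈ Set.Icc (0 : ℝ) ((2 : ℝ) ^ (-(1 / 4) : ℝ) / γ),
      γ ^ 2 * x ^ 2 ≤ 3 / 4 ∧ x ^ 2 ≤ 1 := by
    intro x hx
    constructor
    · rw [← mul_pow]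
      refine (pow_le_pow_left₀ (mul_nonneg hγ0.le hx.1) ?_ 2).trans two_rpow_sq_le
      have := hx.2
      rwa [le_div_iff₀ hγ0, mul_comm] at this
    · exact pow_le_one₀ hx.1 (hx.2.trans ((div_le_one hγ0).mpr hγ))
  obtain ⟨E, hdeg, hb, hacc⟩ : ∃ E : ℝ[X],
      ((2 * E.natDegree + 1 : ℕ) : ℝ) ≤ 1300000 * (γ * Real.log (γ / ε)) ∧
      (∀ t ∈ Set.Icc (0 : ℝ) 1, t * (γ * E.eval t) ^ 2 ≤ 1) ∧
      (∀ t, 0 ≤ t → γ ^ 2 * t ≤ 3 / 4 → |E.eval t - 1| ≤ ε) := by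
    rcases le_total 1 γ with h | h
    · exact exists_amplification_poly h hε hε'
    · refine ⟨1, ?_, ?_, ?_⟩
      · have h45 := le_two_rpow.trans hγ
        have h1 : 8 / 5 ≤ γ / ε := by rw [le_div_iff₀ hε]; linarith
        have h2 := Real.log_le_log (by norm_num) h1
        have h3 := Real.one_sub_inv_le_log_of_pos (by norm_num : (0 : ℝ) < 8 / 5)
        simp only [natDegree_one]
        norm_num at h3 ⊢
        nlinarith
      · intro t ht
        rw [eval_one, mul_one]
        exact mul_le_one₀ ht.2 (sq_nonneg _) (pow_le_one₀ hγ0.le h)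
      · intro t _ _
        simpa using hε.le
  obtain ⟨Φ, huses, hΦ⟩ := exists_phases (E := C γ * E) (k := E.natDegree)
    (natDegree_C_mul_le _ _) (by simpa using hb)
  refine ⟨Φ, fun x hxm => ?_, by rw [huses]; exact hdeg⟩
  obtain ⟨h1, h2⟩ := hx x hxm
  rw [hΦ x h2, eval_mul, eval_C,
    show x * (γ * E.eval (x ^ 2)) - γ * x = (E.eval (x ^ 2) - 1) * (γ * x) by ring, abs_mul,
    abs_of_nonneg (mul_nonneg hγ0.le hxm.1)]
  exact mul_le_mul_of_nonneg_right (hacc _ (sq_nonneg x) h1) (mul_nonneg hγ0.le hxm.1)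

end Amplification

/-! ### Singular values of the two halves -/

section SingularValues

/-- The labelling of the transposed matrix; it exchanges the roles of the two halves. -/
def Labelling.transpose {N D M : ℕ} {A : Matrix (Fin N) (Fin N) ℝ} (L : Labelling A D M) :
    Labelling Aᵀ D M where
  val := L.val
  val_ne_zero := L.val_ne_zero
  inRange := L.inRange
  row := L.col
  col := L.row
  entry_eq := L.entry_eq
  existsUnique_label i j h := by
    obtain ⟨x, ⟨h1, h2, h3⟩, hx⟩ := L.existsUnique_label j i h
    exact ⟨x, ⟨h1, h3, h2⟩, fun y hy => hx y ⟨hy.1, hy.2.2, hy.2.1⟩⟩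

variable {N D M : ℕ} {A : Matrix (Fin N) (Fin N) ℝ} (L : Labelling A D M)

lemma dataMax_transpose (q : ℝ) : dataMax L.transpose q = dataMax L q := rfl

lemma zetaRow_eq_zetaCol_transpose (p : ℝ) (Sr : ℕ) (i : Fin N) :
    zetaRow L p Sr i = zetaCol L.transpose (1 - p) Sr i := by
  rw [zetaRow, zetaCol, dataMax_transpose, mul_sub, mul_one]
  rfl

lemma gammaRow_eq_gammaCol_transpose (p : ℝ) (Sr : ℕ) :
    gammaRow L p Sr = gammaCol L.transpose (1 - p) Sr := by
  simp only [gammaRow, gammaCol, zetaRow_eq_zetaCol_transpose]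

lemma exists_mem_inRange (hA : A ≠ 0) : ∃ x, x ∈ L.inRange := by
  by_contra h
  push Not at h
  refine hA (Matrix.ext fun i j => ?_)
  by_contra hij
  obtain ⟨x, hx, -⟩ := L.existsUnique_label i j hij
  exact h x hx.1

lemma colSum_eq_sum_inRange (q : ℝ) (j : Fin N) :
    colSum A q j = ∑ x ∈ L.inRange with L.col x = j, |L.val x.1| ^ q := by
  rw [colSum, ← Finset.sum_filter_add_sum_filter_not Finset.univ (fun i => A i j = 0),
    Finset.sum_eq_zero (s := Finset.univ.filter fun i => A i j = 0), zero_add]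
  · symm
    refine Finset.sum_nbij L.row ?_ ?_ ?_ ?_
    · intro x hx
      rw [Finset.mem_filter] at hx ⊢
      rw [← hx.2, L.entry_eq x hx.1]
      exact ⟨Finset.mem_univ _, L.val_ne_zero _⟩
    · intro x hx y hy hxy
      simp only [Finset.coe_filter, Set.mem_ofPred_eq] at hx hy
      have hne : A (L.row x) j ≠ 0 := by
        rw [← hx.2, L.entry_eq x hx.1]
        exact L.val_ne_zero _
      exact (L.existsUnique_label _ _ hne).unique ⟨hx.1, rfl, hx.2⟩ ⟨hy.1, hxy.symm, hy.2⟩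
    · intro i hi
      simp only [Finset.coe_filter, Set.mem_ofPred_eq, Finset.mem_univ, true_and] at hi
      obtain ⟨x, ⟨hx, hr, hc⟩, -⟩ := L.existsUnique_label i j hi
      exact ⟨x, by simp [hx, hc], hr⟩
    · intro x hx
      rw [Finset.mem_filter] at hx
      rw [← hx.2, L.entry_eq x hx.1, if_neg (L.val_ne_zero _)]
  · intro i hi
    rw [Finset.mem_filter] at hi
    rw [if_pos hi.2]

lemma colSum_nonneg (q : ℝ) (j : Fin N) : 0 ≤ colSum A q j := by
  refine Finset.sum_nonneg fun i _ => ?_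
  split_ifs
  · exact le_rfl
  · positivity

lemma colSum_col_pos (q : ℝ) {x : Fin D × Fin M} (hx : x ∈ L.inRange) :
    0 < colSum A q (L.col x) := by
  rw [colSum_eq_sum_inRange L]
  refine Finset.sum_pos (fun y _ => Real.rpow_pos_of_pos (abs_pos.mpr (L.val_ne_zero _)) _) ?_
  exact ⟨x, by simp [hx]⟩

/-- The maximal singular value is positive, and it is given by the maximal column sum. -/
lemma iSup_zetaCol (hA : A ≠ 0) {p : ℝ} (hp : 0 ≤ p) {Sc : ℕ} (hSc : 0 < Sc) :
    0 < ⨆ j, zetaCol L p Sc j ∧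
    (⨆ j, zetaCol L p Sc j) = √(⨆ j, colSum A (2 * p) j) / (√Sc * dataMax L p) := by
  obtain ⟨x, hx⟩ := exists_mem_inRange L hA
  have : Nonempty (Fin N) := ⟨L.col x⟩
  have : Nonempty (Fin D) := ⟨x.1⟩
  obtain ⟨j₀, hj₀⟩ := Finite.exists_max fun j => colSum A (2 * p) j
  have hd := dataMax_pos (L := L) (q := p) x.1
  have hd2 : dataMax L (2 * p) = dataMax L p ^ 2 := by
    rw [sq, dataMax_mul hp hp, two_mul]
  have hS : (0 : ℝ) < Sc := by exact_mod_cast hSc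
  have h1 : (⨆ j, colSum A (2 * p) j) = colSum A (2 * p) j₀ :=
    le_antisymm (ciSup_le hj₀) (le_ciSup (Set.finite_range _).bddAbove j₀)
  have h2 : (⨆ j, zetaCol L p Sc j) = zetaCol L p Sc j₀ := by
    refine le_antisymm (ciSup_le fun j => ?_) (le_ciSup (Set.finite_range _).bddAbove j₀)
    refine Real.sqrt_le_sqrt (div_le_div_of_nonneg_right (hj₀ j) ?_)
    rw [hd2]
    positivity
  have h3 : 0 < colSum A (2 * p) j₀ := (colSum_col_pos L _ hx).trans_le (hj₀ _)
  have h4 : zetaCol L p Sc j₀ = √(colSum A (2 * p) j₀) / (√Sc * dataMax L p) := by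
    rw [zetaCol, Real.sqrt_div h3.le, hd2, Real.sqrt_mul hS.le, Real.sqrt_sq hd.le]
  rw [h1, h2, h4]
  exact ⟨div_pos (Real.sqrt_pos.mpr h3) (mul_pos (Real.sqrt_pos.mpr hS) hd), rfl⟩

lemma zetaCol_sq {p : ℝ} (hp : 0 ≤ p) (Sc : ℕ) (j : Fin N) {c : Fin D × Fin M → ℝ}
    (hc : ∀ x, |c x| = |L.val x.1| ^ p / (√Sc * dataMax L p)) :
    ∑ x ∈ L.inRange with L.col x = j, c x ^ 2 = zetaCol L p Sc j ^ 2 := by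
  rcases isEmpty_or_nonempty (Fin D) with h | ⟨⟨d⟩⟩
  · rw [zetaCol, colSum_eq_sum_inRange L]
    have : L.inRange = ∅ := Finset.eq_empty_of_isEmpty _
    simp [this]
  have : Nonempty (Fin D) := ⟨d⟩
  have hd := dataMax_pos (L := L) (q := p) d
  have hd2 : dataMax L (2 * p) = dataMax L p ^ 2 := by
    rw [sq, dataMax_mul hp hp, two_mul]
  rw [zetaCol, Real.sq_sqrt (div_nonneg (colSum_nonneg _ _) (by rw [hd2]; positivity)),
    colSum_eq_sum_inRange L, Finset.sum_div]
  refine Finset.sum_congr rfl fun x _ => ?_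
  rw [← sq_abs, hc, div_pow, mul_pow, Real.sq_sqrt (Nat.cast_nonneg _), hd2, ← Real.rpow_natCast,
    ← Real.rpow_mul (abs_nonneg _), mul_comm p]
  norm_num

end SingularValues

section Isometry

variable {ι κ : Type*} [Fintype κ] [DecidableEq ι]

lemma conjTranspose_mul_self_apply_self {ι κ : Type*} [Fintype κ] (B : Matrix κ ι ℂ) (j : ι) :
    (Bᴴ * B) j j = ((∑ x, ‖B x j‖ ^ 2 : ℝ) : ℂ) := by
  rw [Matrix.mul_apply, Complex.ofReal_sum]
  refine Finset.sum_congr rfl fun y _ => ?_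
  rw [Matrix.conjTranspose_apply, Complex.star_def, Complex.conj_mul']
  push_cast
  rfl

/-- Normalising the orthogonal columns of `B`, and replacing the zero columns by those of an
isometry `V` that is orthogonal to `B` off the diagonal. -/
lemma exists_isometry_mul_diagonal [Fintype ι] {B V : Matrix κ ι ℂ} {ζ : ι → ℝ}
    (hB : Bᴴ * B = diagonal fun j => (ζ j : ℂ) ^ 2) (hV : Vᴴ * V = 1)
    (hVB : ∀ j j', j ≠ j' → (Vᴴ * B) j j' = 0) :
    ∃ W : Matrix κ ι ℂ, Wᴴ * W = 1 ∧ B = W * diagonal fun j => (ζ j : ℂ) := by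
  have hBV : ∀ j j', j ≠ j' → (Bᴴ * V) j j' = 0 := by
    intro j j' h
    have := congrArg star (hVB j' j (Ne.symm h))
    rwa [← Matrix.conjTranspose_apply, conjTranspose_mul, conjTranspose_conjTranspose,
      star_zero] at this
  refine ⟨Matrix.of fun x j => if ζ j = 0 then V x j else B x j / ζ j, ?_, ?_⟩
  · ext j j'
    have h1 := congrFun (congrFun hB j) j'
    have h2 := congrFun (congrFun hV j) j'
    have h3 := hVB j j'
    have h4 := hBV j j'
    simp only [Matrix.mul_apply, Matrix.conjTranspose_apply, Matrix.of_apply] at h1 h2 h3 h4 ⊢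
    by_cases hj : ζ j = 0 <;> by_cases hj' : ζ j' = 0
    · simpa only [hj, hj', if_true] using h2
    · have hne : j ≠ j' := by rintro rfl; exact hj' hj
      simp only [hj, hj', if_true, if_false, mul_div_assoc', ← Finset.sum_div, h3 hne,
        Matrix.one_apply_ne hne, zero_div]
    · have hne : j ≠ j' := by rintro rfl; exact hj hj'
      simp only [hj, hj', if_true, if_false, star_div₀, div_mul_eq_mul_div, ← Finset.sum_div,
        h4 hne, Matrix.one_apply_ne hne, zero_div]
    · simp only [hj, hj', if_false, star_div₀, div_mul_div_comm, ← Finset.sum_div, h1]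
      by_cases hne : j = j'
      · subst hne
        have : (ζ j : ℂ) ≠ 0 := by exact_mod_cast hj
        simp only [diagonal_apply_eq, Matrix.one_apply_eq, Complex.star_def, Complex.conj_ofReal]
        field_simp
      · simp [diagonal_apply_ne _ hne, Matrix.one_apply_ne hne]
  · ext x j
    rw [mul_diagonal, Matrix.of_apply]
    split_ifs with hj
    · rw [hj, Complex.ofReal_zero, mul_zero]
      have h1 := congrFun (congrFun hB j) j
      rw [conjTranspose_mul_self_apply_self, diagonal_apply_eq, hj, Complex.ofReal_zero,
        zero_pow two_ne_zero, Complex.ofReal_eq_zero,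
        Finset.sum_eq_zero_iff_of_nonneg fun _ _ => by positivity] at h1
      simpa using h1 x (Finset.mem_univ x)
    · have : (ζ j : ℂ) ≠ 0 := by exact_mod_cast hj
      field_simp

/-- A matrix whose columns are supported on the disjoint fibres of `f`. -/
lemma conjTranspose_mul_self_of_fibres [DecidableEq κ] {R : Finset κ} {f : κ → ι} {c : κ → ℝ}
    {B : Matrix κ ι ℂ} (hB : ∀ x j, B x j = if x ∈ R ∧ f x = j then (c x : ℂ) else 0) :
    Bᴴ * B = diagonal fun j => ((∑ x ∈ R with f x = j, c x ^ 2 : ℝ) : ℂ) := by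
  ext j j'
  rw [Matrix.mul_apply]
  by_cases h : j = j'
  · subst h
    rw [diagonal_apply_eq, Complex.ofReal_sum, Finset.sum_filter,
      ← Finset.sum_subset (Finset.subset_univ R)]
    · refine Finset.sum_congr rfl fun x hx => ?_
      by_cases hf : f x = j <;> simp [hB, hx, hf, sq]
    · intro x _ hx
      simp [hB, hx]
  · rw [diagonal_apply_ne _ h]
    refine Finset.sum_eq_zero fun x _ => ?_
    by_cases hf : f x = j
    · have : f x ≠ j' := fun h' => h (hf.symm.trans h')
      simp [hB, this]
    · simp [hB, hf]

/-- A column of a unitary has norm at most `1` on any part of its entries. -/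
lemma sum_norm_sq_le_one {α β κ : Type*} [Fintype α] [Fintype β] [DecidableEq α] [DecidableEq β]
    {U : Matrix β α ℂ} (hU : IsUnitary U) (a : α) {f : κ → β} (hf : Function.Injective f)
    (R : Finset κ) : ∑ x ∈ R, ‖U (f x) a‖ ^ 2 ≤ 1 := by
  have h1 : ∑ y, ‖U y a‖ ^ 2 = 1 := by
    have := congrFun (congrFun hU.2 a) a
    rw [conjTranspose_mul_self_apply_self, Matrix.one_apply_eq] at this
    exact_mod_cast this
  rw [← h1, ← Finset.sum_image (f := fun y => ‖U y a‖ ^ 2) (fun x _ y _ h => hf h)]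
  exact Finset.sum_le_sum_of_subset_of_nonneg (Finset.subset_univ _) fun _ _ _ => by positivity

end Isometry

/-! ### The amplified circuit -/

section Scheme

variable {N D M : ℕ} {A : Matrix (Fin N) (Fin N) ℝ} {L : Labelling A D M}
  {S : ℕ} [NeZero S] {Sc Sr : ℕ} (O : Oracles L S Sc Sr) {p : ℝ}

lemma firstBlock_apply (x : Fin D × Fin M) (j : Fin N) :
    firstBlock O p x j = if x ∈ L.inRange ∧ L.col x = j then
      ((Real.sign (L.val x.1) * |L.val x.1| ^ p / (Real.sqrt Sc * dataMax L p) : ℝ) : ℂ)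
      else 0 := by
  rw [firstBlock_eq_ite]
  by_cases hx : x ∈ L.inRange
  · rw [if_pos hx, firstHalf_apply O hx]
    simp [hx]
  · simp [hx]

lemma secondBlock_apply (i : Fin N) (x : Fin D × Fin M) :
    secondBlock O p i x = if x ∈ L.inRange ∧ L.row x = i then
      ((|L.val x.1| ^ (1 - p) / (Real.sqrt Sr * dataMax L (1 - p)) : ℝ) : ℂ) else 0 := by
  rw [secondBlock_eq_ite]
  by_cases hx : x ∈ L.inRange
  · rw [if_pos hx, secondHalf_apply O hx]
    simp [hx]
  · simp [hx]

lemma abs_secondBlock_value (x : Fin D × Fin M) :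
    |(|L.val x.1| ^ (1 - p) / (Real.sqrt Sr * dataMax L (1 - p)))| =
      |L.val x.1| ^ (1 - p) / (Real.sqrt Sr * dataMax L (1 - p)) := by
  have := (dataMax_pos (L := L) (q := 1 - p) x.1).le
  exact abs_of_nonneg (by positivity)

lemma abs_firstBlock_value (x : Fin D × Fin M) :
    |Real.sign (L.val x.1) * |L.val x.1| ^ p / (Real.sqrt Sc * dataMax L p)| =
      |L.val x.1| ^ p / (Real.sqrt Sc * dataMax L p) := by
  have := (dataMax_pos (L := L) (q := p) x.1).le
  rw [mul_div_assoc, abs_mul, abs_sign_mul _ (L.val_ne_zero _), one_mul]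
  exact abs_of_nonneg (by positivity)

lemma firstBlock_gram (hp : 0 ≤ p) :
    (firstBlock O p)ᴴ * firstBlock O p = diagonal fun j => (zetaCol L p Sc j : ℂ) ^ 2 := by
  rw [conjTranspose_mul_self_of_fibres (firstBlock_apply O)]
  congr 1
  ext j
  rw [zetaCol_sq L hp Sc j abs_firstBlock_value]
  push_cast
  rfl

lemma secondBlock_gram (hp : p ≤ 1) :
    secondBlock O p * (secondBlock O p)ᴴ = diagonal fun i => (zetaRow L p Sr i : ℂ) ^ 2 := by
  have h : ∀ x i, (secondBlock O p)ᴴ x i = if x ∈ L.inRange ∧ L.row x = i then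
      ((|L.val x.1| ^ (1 - p) / (Real.sqrt Sr * dataMax L (1 - p)) : ℝ) : ℂ) else 0 := by
    intro x i
    rw [Matrix.conjTranspose_apply, secondBlock_apply]
    split_ifs
    · rw [Complex.star_def, Complex.conj_ofReal]
    · simp
  have h2 := conjTranspose_mul_self_of_fibres h
  rw [conjTranspose_conjTranspose] at h2
  rw [h2]
  congr 1
  ext i
  rw [zetaRow_eq_zetaCol_transpose]
  have := zetaCol_sq L.transpose (p := 1 - p) (by linarith) Sr i (abs_secondBlock_value (L := L))
  rw [← Complex.ofReal_pow, ← this]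
  rfl

lemma zetaCol_sq_le_one (O : Oracles L S Sc Sr) (hp : 0 ≤ p) (j : Fin N) : zetaCol L p Sc j ^ 2 ≤ 1 := by
  have h1 := congrFun (congrFun (firstBlock_gram O hp) j) j
  rw [conjTranspose_mul_self_apply_self, diagonal_apply_eq] at h1
  have h2 : ∑ x, ‖firstBlock O p x j‖ ^ 2 = zetaCol L p Sc j ^ 2 := by exact_mod_cast h1
  have h3 := sum_norm_sq_le_one (isUnitary_firstHalf O p) (0, j, 0)
    (f := fun x => (0, x)) (Prod.mk_right_injective 0) L.inRange
  rw [← h2, ← Finset.sum_subset (Finset.subset_univ L.inRange)]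
  · refine le_of_eq_of_le (Finset.sum_congr rfl fun x hx => ?_) h3
    rw [firstBlock_eq_ite, if_pos hx]
  · intro x _ hx
    simp [firstBlock_eq_ite, hx]

lemma zetaRow_sq_le_one (O : Oracles L S Sc Sr) (hp : p ≤ 1) (i : Fin N) : zetaRow L p Sr i ^ 2 ≤ 1 := by
  have h1 := congrFun (congrFun (secondBlock_gram O hp) i) i
  have h0 := conjTranspose_mul_self_apply_self (secondBlock O p)ᴴ i
  rw [conjTranspose_conjTranspose] at h0
  rw [h0, diagonal_apply_eq] at h1
  have h2 : ∑ x, ‖(secondBlock O p)ᴴ x i‖ ^ 2 = zetaRow L p Sr i ^ 2 := by exact_mod_cast h1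
  have h3 := sum_norm_sq_le_one (isUnitary_secondHalf O p).conjTranspose (0, i, 0)
    (f := fun x => (0, x)) (Prod.mk_right_injective 0) L.inRange
  rw [← h2, ← Finset.sum_subset (Finset.subset_univ L.inRange)]
  · refine le_of_eq_of_le (Finset.sum_congr rfl fun x hx => ?_) h3
    rw [Matrix.conjTranspose_apply, Matrix.conjTranspose_apply, secondBlock_eq_ite, if_pos hx]
  · intro x _ hx
    simp [secondBlock_eq_ite, hx]

/-- The rows `⟨j, 0|` of an oracle are orthonormal, and those of different columns of `A` have
disjoint supports on in-range labels. Hence they can replace the singular vectors of zero columns. -/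
lemma oracle_isometry {X : Matrix (Fin N × Fin S) (Fin D × Fin M) ℂ} (hX : IsUnitary X)
    {R : Finset (Fin D × Fin M)} {f : Fin D × Fin M → Fin N}
    (hspec : ∀ x ∈ R, ∃ s : Fin S, ∀ y, X y x = if y = (f x, s) then 1 else 0)
    {B : Matrix (Fin D × Fin M) (Fin N) ℂ} (hB : ∀ x j, ¬ (x ∈ R ∧ f x = j) → B x j = 0)
    {ζ : Fin N → ℝ} (hgram : Bᴴ * B = diagonal fun j => (ζ j : ℂ) ^ 2) :
    ∃ W : Matrix (Fin D × Fin M) (Fin N) ℂ, Wᴴ * W = 1 ∧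
      B = W * diagonal fun j => (ζ j : ℂ) := by
  refine exists_isometry_mul_diagonal (V := Xᴴ.submatrix id fun j => (j, 0)) hgram ?_ ?_
  · ext i j
    have h := congrFun (congrFun hX.1 (i, 0)) (j, 0)
    simp only [Matrix.mul_apply, Matrix.conjTranspose_apply, submatrix_apply, id_eq,
      star_star] at h ⊢
    rw [h, Matrix.one_apply, Matrix.one_apply]
    simp
  · intro i j hij
    rw [Matrix.mul_apply]
    refine Finset.sum_eq_zero fun x _ => ?_
    by_cases hx : x ∈ R ∧ f x = j
    · obtain ⟨s, hs⟩ := hspec x hx.1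
      have : (i, (0 : Fin S)) ≠ (f x, s) := by
        intro h
        exact hij ((Prod.ext_iff.mp h).1.trans hx.2)
      simp [hs, this]
    · rw [hB x j hx, mul_zero]

lemma firstBlock_svd (hp : 0 ≤ p) : ∃ W : Matrix (Fin D × Fin M) (Fin N) ℂ, Wᴴ * W = 1 ∧
    firstBlock O p = W * Matrix.diagonal fun j => (zetaCol L p Sc j : ℂ) := by
  refine oracle_isometry O.Oc_unitary (R := L.inRange) (f := L.col) ?_ ?_ (firstBlock_gram O hp)
  · intro x hx
    obtain ⟨s, -, hs⟩ := O.Oc_spec x hx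
    exact ⟨s, hs⟩
  · intro x j h
    rw [firstBlock_apply, if_neg h]

lemma secondBlock_svd (hp : p ≤ 1) : ∃ W : Matrix (Fin D × Fin M) (Fin N) ℂ, Wᴴ * W = 1 ∧
    secondBlock O p = (Matrix.diagonal fun i => (zetaRow L p Sr i : ℂ)) * Wᴴ := by
  obtain ⟨W, hW, h⟩ := oracle_isometry O.Or_unitary (R := L.inRange) (f := L.row)
    (B := (secondBlock O p)ᴴ) (ζ := zetaRow L p Sr) (by
      intro x hx
      obtain ⟨s, -, hs⟩ := O.Or_spec x hx
      exact ⟨s, hs⟩) (by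
      intro x i h
      rw [Matrix.conjTranspose_apply, secondBlock_apply, if_neg h, star_zero]) (by
      rw [conjTranspose_conjTranspose]
      exact secondBlock_gram O hp)
  refine ⟨W, hW, ?_⟩
  have := congrArg conjTranspose h
  rw [conjTranspose_conjTranspose, conjTranspose_mul, diagonal_conjTranspose] at this
  rw [this]
  congr 2
  ext i
  simp

/-- The function of the singular values that the amplified halves implement. It is set to `0` at
`ζ = 0`, since the singular vectors of `ζ = 0` in an isometry `W` may leave the accepted space. -/
noncomputable def transformedValue (Φ : Phases) (ζ : ℝ) : ℝ :=
  if ζ = 0 then 0 else svtPolynomial Φ ζ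

lemma isometry_apply {κ ι : Type*} [Fintype κ] [DecidableEq ι] {W : Matrix κ ι ℂ}
    (hW : Wᴴ * W = 1) (i j : ι) : ∑ x, star (W x i) * W x j = if i = j then 1 else 0 := by
  have := congrFun (congrFun hW i) j
  rwa [Matrix.mul_apply, Matrix.one_apply] at this

lemma firstAmplified_apply (hp : 0 ≤ p) {W : Matrix (Fin D × Fin M) (Fin N) ℂ}
    (hW : Wᴴ * W = 1)
    (hB : firstBlock O p = W * Matrix.diagonal fun j => (zetaCol L p Sc j : ℂ)) (Φ : Phases)
    {x : Fin D × Fin M} (hx : x ∈ L.inRange) (j : Fin N) :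
    firstAmplified O p Φ (0, x) (0, j, 0) = W x j * transformedValue Φ (zetaCol L p Sc j) := by
  have hB' : ∀ x j, firstBlock O p x j = W x j * zetaCol L p Sc j := by
    intro x j
    rw [hB, mul_diagonal]
  have h := svtCircuit_block (isUnitary_firstHalf O p)
    (P' := fun y => y.1 = 0 ∧ y.2 ∈ L.inRange) (P := fun x => x.1 = 0 ∧ x.2.2 = 0)
    (v := fun i => Pi.single (0, i, 0) 1) (w := fun i y => if y.1 = 0 then W y.2 i else 0)
    (ζ := zetaCol L p Sc) (zetaCol_sq_le_one O hp)
    (by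
      rintro i _ a ha
      rw [Pi.single_apply, if_neg]
      rintro rfl
      exact ha ⟨rfl, rfl⟩)
    (by
      rintro i hi ⟨f, y⟩ hy
      have : (zetaCol L p Sc i : ℂ) ≠ 0 := by exact_mod_cast hi
      by_cases hf : f = 0
      · have hyR : y ∉ L.inRange := fun h => hy ⟨hf, h⟩
        have h1 := hB' y i
        rw [firstBlock_eq_ite, if_neg hyR] at h1
        simpa [hf, this] using h1.symm
      · simp [hf])
    (by
      intro i j
      simp [Pi.single_apply, apply_ite, eq_comm])
    (by
      intro i j
      rw [Fintype.sum_prod_type, Fin.sum_univ_two]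
      simpa using isometry_apply hW i j)
    (by
      rintro ⟨f, y⟩ ⟨g, k, s⟩ ⟨hf, hy⟩ ⟨hg, hs⟩
      dsimp only at hf hg hs hy
      subst hf hg hs
      have h1 := hB' y k
      rw [firstBlock_eq_ite, if_pos hy] at h1
      rw [h1]
      simp [Pi.single_apply, mul_comm])
    Φ (y := (0, x)) (x := (0, j, 0)) ⟨rfl, hx⟩ ⟨rfl, rfl⟩
  refine Eq.trans h ?_
  by_cases h0 : zetaCol L p Sc j = 0 <;>
    simp [Pi.single_apply, transformedValue, apply_ite, mul_comm, h0]

lemma secondAmplified_apply (hp : p ≤ 1) {W : Matrix (Fin D × Fin M) (Fin N) ℂ}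
    (hW : Wᴴ * W = 1)
    (hB : secondBlock O p = (Matrix.diagonal fun i => (zetaRow L p Sr i : ℂ)) * Wᴴ) (Φ : Phases)
    {x : Fin D × Fin M} (hx : x ∈ L.inRange) (i : Fin N) :
    secondAmplified O p Φ (0, i, 0) (0, x) =
      transformedValue Φ (zetaRow L p Sr i) * star (W x i) := by
  have hB' : ∀ i x, secondBlock O p i x = zetaRow L p Sr i * star (W x i) := by
    intro i x
    rw [hB, diagonal_mul, Matrix.conjTranspose_apply]
  have h := svtCircuit_block (isUnitary_secondHalf O p)
    (P := fun y => y.1 = 0 ∧ y.2 ∈ L.inRange) (P' := fun x => x.1 = 0 ∧ x.2.2 = 0)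
    (w := fun i => Pi.single (0, i, 0) 1) (v := fun i y => if y.1 = 0 then W y.2 i else 0)
    (ζ := zetaRow L p Sr) (zetaRow_sq_le_one O hp)
    (by
      rintro i hi ⟨f, y⟩ hy
      have : (zetaRow L p Sr i : ℂ) ≠ 0 := by exact_mod_cast hi
      by_cases hf : f = 0
      · have hyR : y ∉ L.inRange := fun h => hy ⟨hf, h⟩
        have h1 := hB' i y
        rw [secondBlock_eq_ite, if_neg hyR] at h1
        simpa [hf, this] using h1.symm
      · simp [hf])
    (by
      rintro i _ a ha
      rw [Pi.single_apply, if_neg]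
      rintro rfl
      exact ha ⟨rfl, rfl⟩)
    (by
      intro i j
      rw [Fintype.sum_prod_type, Fin.sum_univ_two]
      simpa using isometry_apply hW i j)
    (by
      intro i j
      simp [Pi.single_apply, apply_ite, eq_comm])
    (by
      rintro ⟨g, k, s⟩ ⟨f, y⟩ ⟨hg, hs⟩ ⟨hf, hy⟩
      dsimp only at hf hg hs hy
      subst hf hg hs
      have h1 := hB' k y
      rw [secondBlock_eq_ite, if_pos hy] at h1
      rw [h1]
      simp [Pi.single_apply])
    Φ (y := (0, i, 0)) (x := (0, x)) ⟨rfl, rfl⟩ ⟨rfl, hx⟩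
  refine Eq.trans h ?_
  by_cases h0 : zetaRow L p Sr i = 0 <;>
    simp [Pi.single_apply, transformedValue, apply_ite, h0]

end Scheme

/-! ### Error analysis -/

section Norm

open scoped Matrix.Norms.L2Operator

variable {ι κ : Type*} [Fintype ι] [DecidableEq ι] [Fintype κ] [DecidableEq κ]

lemma norm_diagonal_ofReal_le {f : ι → ℝ} {r : ℝ} (hr : 0 ≤ r) (hf : ∀ i, |f i| ≤ r) :
    ‖(diagonal fun i => (f i : ℂ) : Matrix ι ι ℂ)‖ ≤ r := by
  rw [l2_opNorm_diagonal, pi_norm_le_iff_of_nonneg hr]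
  intro i
  rw [Complex.norm_real]
  exact hf i

lemma norm_isometry_le_one {κ : Type*} [Fintype κ] {W : Matrix κ ι ℂ} (hW : Wᴴ * W = 1) : ‖W‖ ≤ 1 := by
  have h := l2_opNorm_conjTranspose_mul_self W
  have h1 : ‖(1 : Matrix ι ι ℂ)‖ ≤ 1 := by
    simpa using norm_diagonal_ofReal_le (ι := ι) (f := fun _ => 1) zero_le_one (by simp)
  rw [hW] at h
  nlinarith [norm_nonneg W]

/-- Replacing the diagonal factors of `diag g' · W'† W · diag g` by approximations. -/
lemma norm_diagonal_sandwich_sub_le {W W' : Matrix κ ι ℂ} (hW : Wᴴ * W = 1) (hW' : W'ᴴ * W' = 1)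
    {f g f' g' : ι → ℝ} {ε : ℝ} (hε : 0 ≤ ε) (hg : ∀ i, |g i| ≤ 1) (hg' : ∀ i, |g' i| ≤ 1)
    (hfg : ∀ i, |g i - f i| ≤ ε) (hfg' : ∀ i, |g' i - f' i| ≤ ε) :
    ‖Matrix.toEuclideanCLM (n := ι) (𝕜 := ℂ)
      ((diagonal fun i => (g' i : ℂ)) * (W'ᴴ * W) * (diagonal fun i => (g i : ℂ)) -
        (diagonal fun i => (f' i : ℂ)) * (W'ᴴ * W) * (diagonal fun i => (f i : ℂ)))‖ ≤
      2 * ε + ε ^ 2 := by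
  rw [l2_opNorm_toEuclideanCLM]
  have hK : ‖W'ᴴ * W‖ ≤ 1 := by
    refine (l2_opNorm_mul _ _).trans ?_
    rw [l2_opNorm_conjTranspose]
    exact mul_le_one₀ (norm_isometry_le_one hW') (norm_nonneg _) (norm_isometry_le_one hW)
  have hG := norm_diagonal_ofReal_le zero_le_one hg
  have hG' := norm_diagonal_ofReal_le zero_le_one hg'
  have hE := norm_diagonal_ofReal_le hε hfg
  have hE' := norm_diagonal_ofReal_le hε hfg'
  have hd : ∀ a b : ι → ℝ, (diagonal fun i => ((a i - b i : ℝ) : ℂ) : Matrix ι ι ℂ) =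
      (diagonal fun i => (a i : ℂ)) - diagonal fun i => (b i : ℂ) := by
    intro a b
    rw [diagonal_sub]
    congr 1
    ext i
    push_cast
    rfl
  rw [hd] at hE hE'
  generalize W'ᴴ * W = K at hK ⊢
  generalize (diagonal fun i => (g i : ℂ) : Matrix ι ι ℂ) = G at *
  generalize (diagonal fun i => (g' i : ℂ) : Matrix ι ι ℂ) = G' at *
  generalize (diagonal fun i => (f i : ℂ) : Matrix ι ι ℂ) = F at *
  generalize (diagonal fun i => (f' i : ℂ) : Matrix ι ι ℂ) = F' at *
  have h3 : ∀ (X Y : Matrix ι ι ℂ) (a b : ℝ), 0 ≤ a → ‖X‖ ≤ a → ‖Y‖ ≤ b → ‖X * K * Y‖ ≤ a * b := by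
    intro X Y a b ha hX hY
    calc ‖X * K * Y‖ ≤ ‖X‖ * ‖K‖ * ‖Y‖ :=
          (l2_opNorm_mul _ _).trans (mul_le_mul_of_nonneg_right (l2_opNorm_mul _ _) (norm_nonneg _))
      _ ≤ a * 1 * b := by gcongr
      _ = a * b := by ring
  have hsplit : G' * K * G - F' * K * F =
      (G' - F') * K * G + G' * K * (G - F) - (G' - F') * K * (G - F) := by noncomm_ring
  rw [hsplit]
  calc _ ≤ ‖(G' - F') * K * G‖ + ‖G' * K * (G - F)‖ + ‖(G' - F') * K * (G - F)‖ :=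
        (norm_sub_le _ _).trans (add_le_add_left (norm_add_le _ _) _)
    _ ≤ ε * 1 + 1 * ε + ε * ε :=
        add_le_add (add_le_add (h3 _ _ _ _ hε hE' hG) (h3 _ _ _ _ zero_le_one hG' hE))
          (h3 _ _ _ _ hε hE' hE)
    _ = 2 * ε + ε ^ 2 := by ring

end Norm

section Final

variable {N D M : ℕ} {A : Matrix (Fin N) (Fin N) ℝ} {L : Labelling A D M}
  {S : ℕ} [NeZero S] {Sc Sr : ℕ} (O : Oracles L S Sc Sr) {p : ℝ}

lemma pos_of_oracles (O : Oracles L S Sc Sr) (hA : A ≠ 0) : 0 < Sc ∧ 0 < Sr := by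
  obtain ⟨x, hx⟩ := exists_mem_inRange L hA
  obtain ⟨s, hs, -⟩ := O.Oc_spec x hx
  obtain ⟨t, ht, -⟩ := O.Or_spec x hx
  exact ⟨by omega, by omega⟩

/-- The two blocks multiply to the encoded matrix: `|A_d|^p |A_d|^(1-p) = |A_d|`. -/
lemma secondBlock_mul_firstBlock (hA : A ≠ 0) :
    A.map (fun a => (a : ℂ)) =
      ((√Sc * dataMax L p * (√Sr * dataMax L (1 - p)) : ℝ) : ℂ) •
        (secondBlock O p * firstBlock O p) := by
  obtain ⟨hSc, hSr⟩ := pos_of_oracles O hA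
  have hSc' : 0 < √(Sc : ℝ) := Real.sqrt_pos.mpr (by exact_mod_cast hSc)
  have hSr' : 0 < √(Sr : ℝ) := Real.sqrt_pos.mpr (by exact_mod_cast hSr)
  have hval : ∀ x : Fin D × Fin M, √Sc * dataMax L p * (√Sr * dataMax L (1 - p)) *
      (|L.val x.1| ^ (1 - p) / (√Sr * dataMax L (1 - p)) *
        (Real.sign (L.val x.1) * |L.val x.1| ^ p / (√Sc * dataMax L p))) = L.val x.1 := by
    intro x
    have h1 := dataMax_pos (L := L) (q := p) x.1
    have h2 := dataMax_pos (L := L) (q := 1 - p) x.1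
    have h3 : |L.val x.1| ^ (1 - p) * |L.val x.1| ^ p = |L.val x.1| := by
      rw [← Real.rpow_add (abs_pos.mpr (L.val_ne_zero _)), sub_add_cancel, Real.rpow_one]
    have h4 : Real.sign (L.val x.1) * |L.val x.1| = L.val x.1 := by
      rcases (L.val_ne_zero x.1).lt_or_gt with h | h
      · rw [Real.sign_of_neg h, abs_of_neg h]; ring
      · rw [Real.sign_of_pos h, abs_of_pos h, one_mul]
    calc _ = Real.sign (L.val x.1) * (|L.val x.1| ^ (1 - p) * |L.val x.1| ^ p) := by
          field_simp
      _ = L.val x.1 := by rw [h3, h4]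
  ext i j
  rw [Matrix.map_apply, Matrix.smul_apply, Matrix.mul_apply, smul_eq_mul]
  by_cases hij : A i j = 0
  · rw [hij, Finset.sum_eq_zero]
    · simp
    · intro x _
      rw [secondBlock_apply, firstBlock_apply]
      by_cases h1 : x ∈ L.inRange ∧ L.row x = i
      · by_cases h2 : x ∈ L.inRange ∧ L.col x = j
        · exfalso
          have := L.entry_eq x h1.1
          rw [h1.2, h2.2, hij] at this
          exact L.val_ne_zero _ this.symm
        · rw [if_neg h2, mul_zero]
      · rw [if_neg h1, zero_mul]
  · obtain ⟨x, ⟨hx, hr, hc⟩, huniq⟩ := L.existsUnique_label i j hij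
    rw [Finset.sum_eq_single x]
    · rw [secondBlock_apply, firstBlock_apply, if_pos ⟨hx, hr⟩, if_pos ⟨hx, hc⟩,
        ← Complex.ofReal_mul, ← Complex.ofReal_mul, hval, ← L.entry_eq x hx, hr, hc]
    · intro y _ hy
      rw [secondBlock_apply, firstBlock_apply]
      by_cases h1 : y ∈ L.inRange ∧ L.row y = i
      · by_cases h2 : y ∈ L.inRange ∧ L.col y = j
        · exact absurd (huniq y ⟨h1.1, h1.2, h2.2⟩) hy
        · rw [if_neg h2, mul_zero]
      · rw [if_neg h1, zero_mul]
    · simp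

lemma isBlockEncoding_split (hA : A ≠ 0) :
    IsBlockEncoding (combine L (secondHalf O p) (firstHalf O p)) A
        (√Sc * dataMax L p * (√Sr * dataMax L (1 - p))) 0 := by
  refine ⟨(isUnitary_secondHalf O p).combine (isUnitary_firstHalf O p), le_of_eq ?_⟩
  have h : (Matrix.of fun i j => combine L (secondHalf O p) (firstHalf O p)
      (0, 0, 0, i, 0) (0, 0, 0, j, 0)) = secondBlock O p * firstBlock O p := by
    ext i j
    rw [Matrix.of_apply, combine_apply, Matrix.mul_apply,
      ← Finset.sum_subset (Finset.subset_univ L.inRange)]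
    · refine Finset.sum_congr rfl fun x hx => ?_
      rw [firstBlock_eq_ite, secondBlock_eq_ite, if_pos hx, if_pos hx]
    · intro x _ hx
      rw [firstBlock_eq_ite, if_neg hx, mul_zero]
  rw [h, secondBlock_mul_firstBlock O hA, sub_self, map_zero, norm_zero]

/-- The facts about an amplification factor that the error analysis uses. -/
lemma gammaCol_spec (L : Labelling A D M) (hA : A ≠ 0) (hp : 0 ≤ p) {Sc : ℕ} (hSc : 0 < Sc)
    (h1 : ∀ j, zetaCol L p Sc j ^ 2 ≤ 1) :
    (2 : ℝ) ^ (-(1 / 4) : ℝ) ≤ gammaCol L p Sc ∧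
    (∀ j, zetaCol L p Sc j ∈ Set.Icc (0 : ℝ) ((2 : ℝ) ^ (-(1 / 4) : ℝ) / gammaCol L p Sc)) ∧
    (∀ j, |gammaCol L p Sc * zetaCol L p Sc j| ≤ 1) ∧
    √Sc * dataMax L p / gammaCol L p Sc =
      √(⨆ j, colSum A (2 * p) j) / (2 : ℝ) ^ (-(1 / 4) : ℝ) := by
  obtain ⟨x, hx⟩ := exists_mem_inRange L hA
  have : Nonempty (Fin N) := ⟨L.col x⟩
  obtain ⟨hpos, heq⟩ := iSup_zetaCol L hA hp hSc
  have hd := dataMax_pos (L := L) (q := p) x.1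
  have hS : 0 < √(Sc : ℝ) := Real.sqrt_pos.mpr (by exact_mod_cast hSc)
  have hc := two_rpow_pos
  have hc1 : (2 : ℝ) ^ (-(1 / 4) : ℝ) ≤ 1 := by
    nlinarith [two_rpow_sq_le]
  have h0 : ∀ j, 0 ≤ zetaCol L p Sc j := fun j => Real.sqrt_nonneg _
  have hle : ∀ j, zetaCol L p Sc j ≤ ⨆ j, zetaCol L p Sc j :=
    le_ciSup (Set.finite_range _).bddAbove
  have hZ1 : ⨆ j, zetaCol L p Sc j ≤ 1 :=
    ciSup_le fun j => (sq_le_one_iff₀ (h0 j)).mp (h1 j)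
  have hγ : gammaCol L p Sc = (2 : ℝ) ^ (-(1 / 4) : ℝ) / ⨆ j, zetaCol L p Sc j := rfl
  have hγ0 : 0 < gammaCol L p Sc := by rw [hγ]; positivity
  refine ⟨?_, fun j => ⟨h0 j, ?_⟩, fun j => ?_, ?_⟩
  · rw [hγ, le_div_iff₀ hpos]
    exact mul_le_of_le_one_right hc.le hZ1
  · rw [hγ, div_div_cancel₀ hc.ne']
    exact hle j
  · rw [abs_of_nonneg (mul_nonneg hγ0.le (h0 j)), hγ, div_mul_eq_mul_div, div_le_one hpos]
    calc _ ≤ 1 * zetaCol L p Sc j := mul_le_mul_of_nonneg_right hc1 (h0 j)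
      _ ≤ _ := by rw [one_mul]; exact hle j
  · rw [hγ, heq]
    field_simp

lemma gammaRow_spec (L : Labelling A D M) (hA : A ≠ 0) (hp : p ≤ 1) {Sr : ℕ} (hSr : 0 < Sr)
    (h1 : ∀ i, zetaRow L p Sr i ^ 2 ≤ 1) :
    (2 : ℝ) ^ (-(1 / 4) : ℝ) ≤ gammaRow L p Sr ∧
    (∀ i, zetaRow L p Sr i ∈ Set.Icc (0 : ℝ) ((2 : ℝ) ^ (-(1 / 4) : ℝ) / gammaRow L p Sr)) ∧
    (∀ i, |gammaRow L p Sr * zetaRow L p Sr i| ≤ 1) ∧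
    √Sr * dataMax L (1 - p) / gammaRow L p Sr =
      √(⨆ i, rowSum A (2 - 2 * p) i) / (2 : ℝ) ^ (-(1 / 4) : ℝ) := by
  simp only [zetaRow_eq_zetaCol_transpose, gammaRow_eq_gammaCol_transpose] at h1 ⊢
  have h := gammaCol_spec L.transpose (p := 1 - p) (by simpa using hA) (by linarith) hSr h1
  rw [mul_sub, mul_one] at h
  exact h

/-- Dividing the subnormalisation by the amplification factors. -/
lemma subnormalisation_div_gamma (L : Labelling A D M) (hA : A ≠ 0) (hp : p ∈ Set.Icc (0 : ℝ) 1)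
    {Sc Sr : ℕ} (hSc : 0 < Sc) (hSr : 0 < Sr) (hc : ∀ j, zetaCol L p Sc j ^ 2 ≤ 1)
    (hr : ∀ i, zetaRow L p Sr i ^ 2 ≤ 1) :
    (√Sc * dataMax L p * (√Sr * dataMax L (1 - p))) / (gammaCol L p Sc * gammaRow L p Sr) =
      preampNorm A p := by
  obtain ⟨-, -, -, h1⟩ := gammaCol_spec L hA hp.1 hSc hc
  obtain ⟨-, -, -, h2⟩ := gammaRow_spec L hA hp.2 hSr hr
  have ha : 0 ≤ ⨆ j, colSum A (2 * p) j := Real.iSup_nonneg fun j => colSum_nonneg _ j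
  have hb : 0 ≤ ⨆ i, rowSum A (2 - 2 * p) i :=
    Real.iSup_nonneg fun i => colSum_nonneg (A := Aᵀ) _ i
  have hc0 := two_rpow_pos
  have h3 : √2 * ((2 : ℝ) ^ (-(1 / 4) : ℝ) * (2 : ℝ) ^ (-(1 / 4) : ℝ)) = 1 := by
    rw [Real.sqrt_eq_rpow, ← Real.rpow_add two_pos, ← Real.rpow_add two_pos]
    norm_num
  rw [← div_mul_div_comm, h1, h2, preampNorm, Real.sqrt_mul (by positivity),
    Real.sqrt_mul (by norm_num), div_mul_div_comm, div_eq_iff (by positivity)]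
  linear_combination (-(√(⨆ j, colSum A (2 * p) j) * √(⨆ i, rowSum A (2 - 2 * p) i))) * h3

lemma isBlockEncoding_amplified (hA : A ≠ 0) (hp : p ∈ Set.Icc (0 : ℝ) 1) {ε : ℝ}
    {Φc Φr : Phases}
    (hΦc : ∀ x ∈ Set.Icc (0 : ℝ) ((2 : ℝ) ^ (-(1 / 4) : ℝ) / gammaCol L p Sc),
      |svtPolynomial Φc x - gammaCol L p Sc * x| ≤ ε)
    (hΦr : ∀ x ∈ Set.Icc (0 : ℝ) ((2 : ℝ) ^ (-(1 / 4) : ℝ) / gammaRow L p Sr),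
      |svtPolynomial Φr x - gammaRow L p Sr * x| ≤ ε) :
    IsBlockEncoding (combine L (secondAmplified O p Φr) (firstAmplified O p Φc)) A
      (preampNorm A p) ((2 * ε + ε ^ 2) * preampNorm A p) := by
  obtain ⟨hSc, hSr⟩ := pos_of_oracles O hA
  obtain ⟨hγc, hζc, hgc, -⟩ := gammaCol_spec L hA hp.1 hSc (zetaCol_sq_le_one O hp.1)
  obtain ⟨hγr, hζr, hgr, -⟩ := gammaRow_spec L hA hp.2 hSr (zetaRow_sq_le_one O hp.2)
  have hγc0 := two_rpow_pos.trans_le hγc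
  have hγr0 := two_rpow_pos.trans_le hγr
  have hsub := subnormalisation_div_gamma L hA hp hSc hSr (zetaCol_sq_le_one O hp.1)
    (zetaRow_sq_le_one O hp.2)
  obtain ⟨W, hW, hB⟩ := firstBlock_svd O (p := p) hp.1
  obtain ⟨W', hW', hB'⟩ := secondBlock_svd O (p := p) hp.2
  have hε : 0 ≤ ε := (abs_nonneg _).trans (hΦc 0 ⟨le_rfl, by positivity⟩)
  refine ⟨IsUnitary.combine
    ((isUnitary_svtCircuit (isUnitary_secondHalf O p) _ _ _).submatrix _ _)
    ((isUnitary_svtCircuit (isUnitary_firstHalf O p) _ _ _).submatrix _ _), ?_⟩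
  -- the exact block, in terms of the scaled singular values
  have hAeq : A.map (fun a => (a : ℂ)) = (preampNorm A p : ℂ) •
      ((diagonal fun i => ((gammaRow L p Sr * zetaRow L p Sr i : ℝ) : ℂ)) * (W'ᴴ * W) *
        (diagonal fun j => ((gammaCol L p Sc * zetaCol L p Sc j : ℝ) : ℂ))) := by
    have hs : √Sc * dataMax L p * (√Sr * dataMax L (1 - p)) =
        preampNorm A p * (gammaCol L p Sc * gammaRow L p Sr) := by
      rw [← hsub]; field_simp
    rw [secondBlock_mul_firstBlock O hA, hs, hB, hB']
    ext i j
    simp only [Matrix.smul_apply, ← Matrix.mul_assoc, mul_diagonal, smul_eq_mul]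
    simp only [Matrix.mul_assoc, diagonal_mul]
    push_cast
    ring
  -- the block of the amplified circuit
  have hblock : (Matrix.of fun i j => combine L (secondAmplified O p Φr) (firstAmplified O p Φc)
      (0, 0, 0, i, 0) (0, 0, 0, j, 0)) =
      (diagonal fun i => (transformedValue Φr (zetaRow L p Sr i) : ℂ)) * (W'ᴴ * W) *
        (diagonal fun j => (transformedValue Φc (zetaCol L p Sc j) : ℂ)) := by
    ext i j
    rw [Matrix.of_apply, combine_apply, mul_diagonal, diagonal_mul, Matrix.mul_apply,
      Finset.mul_sum, Finset.sum_mul, ← Finset.sum_subset (Finset.subset_univ L.inRange)]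
    · refine Finset.sum_congr rfl fun x hx => ?_
      rw [firstAmplified_apply O hp.1 hW hB Φc hx, secondAmplified_apply O hp.2 hW' hB' Φr hx,
        Matrix.conjTranspose_apply]
      ring
    · intro x _ hx
      by_cases h0 : zetaCol L p Sc j = 0
      · simp [transformedValue, h0]
      · have h1 : firstBlock O p x j = W x j * zetaCol L p Sc j := by rw [hB, mul_diagonal]
        rw [firstBlock_eq_ite, if_neg hx] at h1
        have h2 : W x j = 0 := by simpa [h0] using h1.symm
        rw [h2, mul_zero, mul_zero, zero_mul]
  have hdist : ∀ (Φ : Phases) (γ ζ : ℝ), |svtPolynomial Φ ζ - γ * ζ| ≤ ε →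
      |γ * ζ - transformedValue Φ ζ| ≤ ε := by
    intro Φ γ ζ h
    rw [transformedValue]
    split_ifs with h0
    · simpa [h0] using hε
    · rwa [abs_sub_comm]
  have hnorm : 0 ≤ preampNorm A p := Real.sqrt_nonneg _
  rw [hblock, hAeq, ← smul_sub, map_smul, norm_smul, Complex.norm_real, Real.norm_of_nonneg hnorm,
    mul_comm]
  exact mul_le_mul_of_nonneg_right (norm_diagonal_sandwich_sub_le hW hW' hε hgc hgr
    (fun j => hdist _ _ _ (hΦc _ (hζc j))) (fun i => hdist _ _ _ (hΦr _ (hζr i)))) hnorm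

end Final

end Preamp

theorem mainTheorem4 :
    ∃ C : ℝ, 0 < C ∧
    ∀ {N S D M Sc Sr : ℕ} [NeZero S] (A : Matrix (Fin N) (Fin N) ℝ) (_hA : A ≠ 0)
      (L : Labelling A D M) (O : Oracles L S Sc Sr) (p : ℝ) (_hp : p ∈ Set.Icc (0 : ℝ) 1),
      -- the unamplified split circuit is an exact block encoding
      IsBlockEncoding (combine L (secondHalf O p) (firstHalf O p)) A
        (Real.sqrt Sc * dataMax L p * (Real.sqrt Sr * dataMax L (1 - p))) 0 ∧
      -- the first half is a block encoding with singular values `zetaCol`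
      IsUnitary (firstHalf O p) ∧
      (∀ x j, firstBlock O p x j = if x ∈ L.inRange ∧ L.col x = j then
        ((Real.sign (L.val x.1) * |L.val x.1| ^ p / (Real.sqrt Sc * dataMax L p) : ℝ) : ℂ)
        else 0) ∧
      (∃ W : Matrix (Fin D × Fin M) (Fin N) ℂ, Wᴴ * W = 1 ∧
        firstBlock O p = W * Matrix.diagonal fun j => (zetaCol L p Sc j : ℂ)) ∧
      -- the second half is a block encoding with singular values `zetaRow`
      IsUnitary (secondHalf O p) ∧
      (∀ i x, secondBlock O p i x = if x ∈ L.inRange ∧ L.row x = i then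
        ((|L.val x.1| ^ (1 - p) / (Real.sqrt Sr * dataMax L (1 - p)) : ℝ) : ℂ)
        else 0) ∧
      (∃ W : Matrix (Fin D × Fin M) (Fin N) ℂ, Wᴴ * W = 1 ∧
        secondBlock O p = (Matrix.diagonal fun i => (zetaRow L p Sr i : ℂ)) * Wᴴ) ∧
      -- dividing the subnormalisation by the amplification factors
      (Real.sqrt Sc * dataMax L p * (Real.sqrt Sr * dataMax L (1 - p)))
        / (gammaCol L p Sc * gammaRow L p Sr) = preampNorm A p ∧
      -- all `ε`-accurate amplifications give an approximate block encoding
      (∀ (ε : ℝ) (Φc Φr : Phases),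
        (∀ x ∈ Set.Icc (0 : ℝ) ((2 : ℝ) ^ (-(1 / 4) : ℝ) / gammaCol L p Sc),
          |svtPolynomial Φc x - gammaCol L p Sc * x| ≤ ε) →
        (∀ x ∈ Set.Icc (0 : ℝ) ((2 : ℝ) ^ (-(1 / 4) : ℝ) / gammaRow L p Sr),
          |svtPolynomial Φr x - gammaRow L p Sr * x| ≤ ε) →
        IsBlockEncoding (combine L (secondAmplified O p Φr) (firstAmplified O p Φc)) A
          (preampNorm A p) ((2 * ε + ε ^ 2) * preampNorm A p)) ∧
      -- amplifications of relative accuracy `ε` exist, with `O(γ log(γ/ε))` uses of the halves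
      (∀ ε : ℝ, 0 < ε → ε < 1 / 2 →
        (∃ Φc : Phases,
          (∀ x ∈ Set.Icc (0 : ℝ) ((2 : ℝ) ^ (-(1 / 4) : ℝ) / gammaCol L p Sc),
            |svtPolynomial Φc x - gammaCol L p Sc * x| ≤ ε * (gammaCol L p Sc * x)) ∧
          (Φc.uses : ℝ) ≤ C * (gammaCol L p Sc * Real.log (gammaCol L p Sc / ε))) ∧
        (∃ Φr : Phases,
          (∀ x ∈ Set.Icc (0 : ℝ) ((2 : ℝ) ^ (-(1 / 4) : ℝ) / gammaRow L p Sr),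
            |svtPolynomial Φr x - gammaRow L p Sr * x| ≤ ε * (gammaRow L p Sr * x)) ∧
          (Φr.uses : ℝ) ≤ C * (gammaRow L p Sr * Real.log (gammaRow L p Sr / ε)))) := by
  refine ⟨1300000, by norm_num, ?_⟩
  intro N S D M Sc Sr _ A hA L O p hp
  obtain ⟨hSc, hSr⟩ := pos_of_oracles O hA
  have hc := zetaCol_sq_le_one O hp.1
  have hr := zetaRow_sq_le_one O hp.2
  exact ⟨isBlockEncoding_split O hA, isUnitary_firstHalf O p, firstBlock_apply O,
    firstBlock_svd O hp.1, isUnitary_secondHalf O p, secondBlock_apply O, secondBlock_svd O hp.2,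
    subnormalisation_div_gamma L hA hp hSc hSr hc hr,
    fun ε Φc Φr h h' => isBlockEncoding_amplified O hA hp h h',
    fun ε hε hε' => ⟨exists_phases_amplification (gammaCol_spec L hA hp.1 hSc hc).1 hε hε',
      exists_phases_amplification (gammaRow_spec L hA hp.2 hSr hr).1 hε hε'⟩⟩
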